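/- Let $S$ be a finite chain ring, that is, a nonzero finite commutative unital ring whose ideals are linearly ordered by inclusion; let $\mathfrak m$ be its maximal ideal and $K=S/\mathfrak m$ its residue field. Let $\sigma\in\mathrm{Aut}(S)$ and let $\delta:S\to S$ be a left $\sigma$-derivation, i.e. an additive map with $\delta(ab)=\sigma(a)\delta(b)+\delta(a)b$ for all $a,b\in S$, such that $\delta(\mathfrak m)\subseteq\mathfrak m$. Let $S[t;\sigma,\delta]$ be the skew polynomial ring with left coefficients and $ta=\sigma(a)t+\delta(a)$ for $a\in S$. Let $\overline\sigma,\overline\delta$ be the maps induced by $\sigma,\delta$ on $K$, and for $g=\sum_i a_it^i\in S[t;\sigma,\delta]$ let $\overline g=\sum_i\overline{a_i}t^i\in K[t;\overline\sigma,\overline\delta]$. Let $f\in S[t;\sigma,\delta]$ be monic of degree $m>1$. Let $S_f$ be the additive group $\{g\in S[t;\sigma,\delta] : \deg g<m\}$ with the multiplication $g\circ h=$ the remainder of $gh$ under right division by $f$ (the unique $r$ with $\deg r<m$ and $gh=qf+r$ for some $q$). Let $S_{\overline f}$ be constructed in the same way from $\overline f\in K[t;\overline\sigma,\overline\delta]$.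 Call $f$ base irreducible if $\overline f$ is irreducible in $K[t;\overline\sigma,\overline\delta]$, i.e. $\overline f$ is not a unit and is not a product of two polynomials of degree smaller than $\deg\overline f$. A semifield is a nonzero finite unital nonassociative ring in which left and right multiplication by each nonzero element are bijective. For a nonassociative ring $A$ put $\mathrm{Nuc}_r(A)=\{x\in A : (ab)x=a(bx)\text{ for all }a,b\in A\}$. Then: (i) The set $S_0=\{a\in S : a\circ h=h\circ a\text{ for all }h\in S_f\}$ is a subring of $S$, and $S_f$ is a unital nonassociative algebra over $S_0$ with finitely many elements (i.e. $S_f$ is finite, $\circ$ is $S_0$-bilinear and has a two-sided unit). (ii) $S_{\overline f}$ is a semifield if and only if $f$ is base irreducible, and if and only if $\mathrm{Nuc}_r(S_{\overline f})$ has no zero divisors (i.e. $x\circ y=0$ with $x,y\in\mathrm{Nuc}_r(S_{\overline f})$ implies $x=0$ or $y=0$). (iii) If $\delta=0$, then $\mathrm{Fix}(\sigma)=\{a\in S:\sigma(a)=a\}\subseteq S_0$. -/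

import Mathlib

noncomputable section

/-! ### Finite chain rings -/

/-- A finite chain ring: a nonzero finite commutative ring whose ideals are linearly ordered by
inclusion. -/
class IsFiniteChainRing (S : Type*) [CommRing S] : Prop where
  finite : Finite S
  nontrivial : Nontrivial S
  ideal_total : ∀ I J : Ideal S, I ≤ J ∨ J ≤ I

instance IsFiniteChainRing.isLocalRing (S : Type*) [CommRing S] [IsFiniteChainRing S] :
    IsLocalRing S := by
  have : Nontrivial S := IsFiniteChainRing.nontrivial
  obtain ⟨M, hM⟩ := Ideal.exists_maximal S
  refine IsLocalRing.of_unique_max_ideal ⟨M, hM, fun N hN => ?_⟩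
  rcases IsFiniteChainRing.ideal_total M N with h | h
  · exact (hM.eq_of_le hN.ne_top h).symm
  · exact hN.eq_of_le hM.ne_top h

/-! ### Skew derivations -/

/-- A (left) `σ`-derivation of a ring `S`: an additive map with
`δ (a * b) = σ a * δ b + δ a * b`. -/
structure SkewDerivation {S : Type*} [Ring S] (σ : S →+* S) where
  toAddMonoidHom : S →+ S
  leibniz : ∀ a b : S, toAddMonoidHom (a * b) = σ a * toAddMonoidHom b + toAddMonoidHom a * b

instance SkewDerivation.instCoeFun {S : Type*} [Ring S] {σ : S →+* S} :
    CoeFun (SkewDerivation σ) (fun _ => S → S) :=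
  ⟨fun δ => δ.toAddMonoidHom⟩

/-! ### The skew polynomial ring -/

/-- The skew polynomial ring `S[t; σ, δ]`: finitely supported sequences of coefficients, the
sequence `(a₀, a₁, …)` being the polynomial `a₀ + a₁ t + ⋯` with coefficients on the left. -/
def SkewPoly {S : Type*} [Ring S] {σ : S →+* S} (_δ : SkewDerivation σ) : Type _ := ℕ →₀ S

namespace SkewPoly

section Basic

variable {S : Type*} [Ring S] {σ : S →+* S} {δ : SkewDerivation σ}

instance instAddCommGroup : AddCommGroup (SkewPoly δ) := inferInstanceAs (AddCommGroup (ℕ →₀ S))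

instance instModule : Module S (SkewPoly δ) := inferInstanceAs (Module S (ℕ →₀ S))

/-- The coefficient of `t ^ i`. -/
def coeff (g : SkewPoly δ) (i : ℕ) : S := (show ℕ →₀ S from g) i

/-- The monomial `a t ^ n`, additively in `a`. -/
def monomial (n : ℕ) : S →+ SkewPoly δ := Finsupp.singleAddHom (M := S) n

theorem ext {g h : SkewPoly δ} (H : ∀ i, coeff g i = coeff h i) : g = h :=
  Finsupp.ext (f := g) (g := h) H

theorem coeff_add (g h : SkewPoly δ) (i : ℕ) : coeff (g + h) i = coeff g i + coeff h i := rfl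

theorem coeff_sub (g h : SkewPoly δ) (i : ℕ) : coeff (g - h) i = coeff g i - coeff h i := rfl

theorem coeff_zero (i : ℕ) : coeff (0 : SkewPoly δ) i = 0 := rfl

theorem coeff_smul (a : S) (g : SkewPoly δ) (i : ℕ) : coeff (a • g) i = a * coeff g i := rfl

theorem coeff_monomial (n i : ℕ) (a : S) :
    coeff (monomial n a : SkewPoly δ) i = if n = i then a else 0 := by
  classical
  change (Finsupp.single n a) i = _
  rw [Finsupp.single_apply]

theorem smul_monomial (n : ℕ) (a b : S) :
    a • (monomial n b : SkewPoly δ) = monomial n (a * b) := by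
  apply ext
  intro i
  rw [coeff_smul, coeff_monomial, coeff_monomial]
  split_ifs <;> simp

theorem addHom_ext {M : Type*} [AddCommMonoid M] {F G : SkewPoly δ →+ M}
    (H : ∀ n a, F (monomial n a) = G (monomial n a)) : F = G :=
  Finsupp.addHom_ext (f := F) (g := G) H

/-- Left multiplication by `t`, determined by `t (b t ^ m) = σ b t ^ (m + 1) + δ b t ^ m`. -/
def tMul : SkewPoly δ →+ SkewPoly δ :=
  Finsupp.liftAddHom (M := S) fun m =>
    (monomial (m + 1)).comp σ.toAddMonoidHom + (monomial m).comp δ.toAddMonoidHom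

theorem tMul_monomial (m : ℕ) (b : S) :
    tMul (monomial m b : SkewPoly δ) = monomial (m + 1) (σ b) + monomial m (δ b) := by
  change Finsupp.liftAddHom _ (Finsupp.single m b) = _
  rw [Finsupp.liftAddHom_apply_single]
  rfl

/-- Left multiplication by `t ^ n`, the `n`-fold iterate of left multiplication by `t`. -/
def tPowMul : ℕ → SkewPoly δ →+ SkewPoly δ
  | 0 => AddMonoidHom.id _
  | n + 1 => tMul.comp (tPowMul n)

theorem tPowMul_apply (n : ℕ) (h : SkewPoly δ) : tPowMul n h = tMul^[n] h := by
  induction n with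
  | zero => rfl
  | succ n ih => rw [Function.iterate_succ_apply', ← ih]; rfl

/-- Left multiplication by the polynomial `g = ∑ aₙ t ^ n`, additively in `g`: it is the map
`h ↦ ∑ aₙ (t (t (⋯ (t h))))`. -/
def leftMul : SkewPoly δ →+ SkewPoly δ →+ SkewPoly δ :=
  Finsupp.liftAddHom (M := S) fun n =>
    { toFun := fun a => (DistribSMul.toAddMonoidHom (SkewPoly δ) a).comp (tPowMul n)
      map_zero' := AddMonoidHom.ext fun x => zero_smul S (tPowMul n x)
      map_add' := fun a b => AddMonoidHom.ext fun x => add_smul a b (tPowMul n x) }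

instance instMul : Mul (SkewPoly δ) := ⟨fun g h => leftMul g h⟩

instance instOne : One (SkewPoly δ) := ⟨monomial 0 1⟩

theorem mul_def (g h : SkewPoly δ) : g * h = leftMul g h := rfl

theorem monomial_mul (n : ℕ) (a : S) (h : SkewPoly δ) :
    monomial n a * h = a • (tMul^[n] h) := by
  have key : leftMul (monomial n a : SkewPoly δ) =
      (DistribSMul.toAddMonoidHom (SkewPoly δ) a).comp (tPowMul n) := by
    change Finsupp.liftAddHom _ (Finsupp.single n a) = _
    rw [Finsupp.liftAddHom_apply_single]
    rfl
  rw [mul_def, key, ← tPowMul_apply]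
  rfl

theorem tMul_smul (a : S) (h : SkewPoly δ) :
    tMul (a • h) = σ a • tMul h + δ a • h := by
  have key : tMul.comp (DistribSMul.toAddMonoidHom (SkewPoly δ) a) =
      (DistribSMul.toAddMonoidHom (SkewPoly δ) (σ a)).comp tMul +
        DistribSMul.toAddMonoidHom (SkewPoly δ) (δ a) := by
    apply addHom_ext
    intro n b
    change tMul (a • monomial n b) = σ a • tMul (monomial n b) + δ a • monomial n b
    rw [smul_monomial, tMul_monomial, tMul_monomial, smul_add, smul_monomial, smul_monomial,
      smul_monomial, map_mul, δ.leibniz, map_add]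
    abel
  exact DFunLike.congr_fun key h

theorem add_mul' (a b c : SkewPoly δ) : (a + b) * c = a * c + b * c := by
  rw [mul_def, map_add]; rfl

theorem mul_add' (a b c : SkewPoly δ) : a * (b + c) = a * b + a * c := by
  rw [mul_def, map_add]; rfl

theorem smul_mul' (a : S) (g h : SkewPoly δ) : (a • g) * h = a • (g * h) := by
  have key : (leftMul.flip h).comp (DistribSMul.toAddMonoidHom (SkewPoly δ) a) =
      (DistribSMul.toAddMonoidHom (SkewPoly δ) a).comp (leftMul.flip h) := by
    apply addHom_ext
    intro n b
    change (a • monomial n b) * h = a • (monomial n b * h)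
    rw [smul_monomial, monomial_mul, monomial_mul, mul_smul]
  exact DFunLike.congr_fun key g

theorem tMul_mul (g h : SkewPoly δ) : tMul g * h = tMul (g * h) := by
  have key : (leftMul.flip h).comp tMul = (tMul (δ := δ)).comp (leftMul.flip h) := by
    apply addHom_ext
    intro n b
    change tMul (monomial n b) * h = tMul (monomial n b * h)
    rw [tMul_monomial, add_mul', monomial_mul, monomial_mul, monomial_mul, tMul_smul,
      Function.iterate_succ_apply']
  exact DFunLike.congr_fun key g

theorem mul_assoc' (a b c : SkewPoly δ) : (a * b) * c = a * (b * c) := by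
  have iter : ∀ (n : ℕ) (g : SkewPoly δ), (tMul^[n] g) * c = tMul^[n] (g * c) := by
    intro n
    induction n with
    | zero => intro g; rfl
    | succ n ih =>
      intro g
      rw [Function.iterate_succ_apply', Function.iterate_succ_apply', tMul_mul, ih]
  have key : (leftMul.flip c).comp (leftMul.flip b) = leftMul.flip (b * c) := by
    apply addHom_ext
    intro n x
    change (monomial n x * b) * c = monomial n x * (b * c)
    rw [monomial_mul, monomial_mul, smul_mul', iter]
  exact DFunLike.congr_fun key a

theorem one_mul' (g : SkewPoly δ) : 1 * g = g := by
  change monomial 0 1 * g = g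
  rw [monomial_mul, one_smul]
  rfl

theorem mul_one' (g : SkewPoly δ) : g * 1 = g := by
  have h1 : δ (1 : S) = 0 := by
    have h := δ.leibniz 1 1
    simpa using h
  have iter : ∀ n : ℕ, tMul^[n] (1 : SkewPoly δ) = monomial n 1 := by
    intro n
    induction n with
    | zero => rfl
    | succ n ih =>
      rw [Function.iterate_succ_apply', ih, tMul_monomial, h1, map_zero, map_one, add_zero]
  have key : leftMul.flip (1 : SkewPoly δ) = AddMonoidHom.id _ := by
    apply addHom_ext
    intro n x
    change monomial n x * 1 = monomial n x
    rw [monomial_mul, iter, smul_monomial, mul_one]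
  exact DFunLike.congr_fun key g

instance instRing : Ring (SkewPoly δ) :=
  { instAddCommGroup, instMul, instOne with
    left_distrib := mul_add'
    right_distrib := add_mul'
    zero_mul := fun a => by rw [mul_def, map_zero]; rfl
    mul_zero := fun a => by rw [mul_def, map_zero]
    mul_assoc := mul_assoc'
    one_mul := one_mul'
    mul_one := mul_one'
    zsmul := instAddCommGroup.zsmul
    zsmul_zero' := instAddCommGroup.zsmul_zero'
    zsmul_succ' := instAddCommGroup.zsmul_succ'
    zsmul_neg' := instAddCommGroup.zsmul_neg'
    nsmul := instAddCommGroup.nsmul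
    nsmul_zero := instAddCommGroup.nsmul_zero
    nsmul_succ := instAddCommGroup.nsmul_succ }

/-- The constant polynomial `a`. -/
def C (a : S) : SkewPoly δ := monomial 0 a

/-- The variable `t`. -/
def t : SkewPoly δ := monomial 1 1

/-- The defining relation `t a = σ(a) t + δ(a)` of the skew polynomial ring. -/
theorem t_mul_C (a : S) : (t * C a : SkewPoly δ) = C (σ a) * t + C (δ a) := by
  change monomial 1 1 * monomial 0 a = monomial 0 (σ a) * monomial 1 1 + monomial 0 (δ a)
  rw [monomial_mul, monomial_mul, one_smul, Function.iterate_one, tMul_monomial,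
    Function.iterate_zero, id, smul_monomial, mul_one]

theorem C_mul_t_pow (a : S) (n : ℕ) : (C a * t ^ n : SkewPoly δ) = monomial n a := by
  have iter : ∀ n : ℕ, (t ^ n : SkewPoly δ) = monomial n 1 := by
    intro n
    have h1 : δ (1 : S) = 0 := by
      have h := δ.leibniz 1 1
      simpa using h
    induction n with
    | zero => rfl
    | succ n ih =>
      rw [pow_succ', ih]
      change monomial 1 1 * _ = _
      rw [monomial_mul, one_smul, Function.iterate_one, tMul_monomial, h1, map_zero, map_one,
        add_zero]
  rw [iter]
  change monomial 0 a * _ = _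
  rw [monomial_mul, Function.iterate_zero, id, smul_monomial, mul_one]

/-- The degree, with `degree 0 = ⊥`. -/
def degree (g : SkewPoly δ) : WithBot ℕ := (show ℕ →₀ S from g).support.max

/-- The degree as a natural number, with value `0` at the zero polynomial. -/
def natDegree (g : SkewPoly δ) : ℕ := g.degree.unbotD 0

/-- The leading coefficient. -/
def leadingCoeff (g : SkewPoly δ) : S := g.coeff g.natDegree

/-- A monic polynomial. -/
def Monic (g : SkewPoly δ) : Prop := g.leadingCoeff = 1

theorem Monic.isUnit {g : SkewPoly δ} (hg : g.Monic) : IsUnit g.leadingCoeff :=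
  hg.symm ▸ isUnit_one

/-- An irreducible skew polynomial: not a unit, and without proper factors, that is, not the
product of two polynomials of smaller degree. -/
def IsIrreducible (f : SkewPoly δ) : Prop :=
  ¬ IsUnit f ∧ ¬ ∃ g h : SkewPoly δ, g.degree < f.degree ∧ h.degree < f.degree ∧ f = g * h

theorem degree_lt_iff (g : SkewPoly δ) (n : ℕ) :
    g.degree < (n : WithBot ℕ) ↔ ∀ i, n ≤ i → g.coeff i = 0 := by
  constructor
  · intro h i hi
    by_contra hne
    have hmem : i ∈ (show ℕ →₀ S from g).support := Finsupp.mem_support_iff.mpr hne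
    have h1 : (i : WithBot ℕ) ≤ g.degree := Finset.le_max hmem
    exact absurd (WithBot.coe_lt_coe.mp (lt_of_le_of_lt h1 h)) (not_lt.mpr hi)
  · intro h
    refine (Finset.sup_lt_iff (WithBot.bot_lt_coe n)).mpr fun i hi => ?_
    refine WithBot.coe_lt_coe.mpr (not_le.mp fun hni => ?_)
    exact (Finsupp.mem_support_iff.mp hi) (h i hni)

theorem coeff_eq_zero_of_natDegree_lt (g : SkewPoly δ) (i : ℕ) (hi : g.natDegree < i) :
    g.coeff i = 0 := by
  by_contra hne
  have hmem : i ∈ (show ℕ →₀ S from g).support := Finsupp.mem_support_iff.mpr hne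
  have h1 : (i : WithBot ℕ) ≤ g.degree := Finset.le_max hmem
  have h2 : i ≤ g.natDegree := by
    unfold natDegree
    cases hd : g.degree with
    | bot => rw [hd] at h1; simp at h1
    | coe d => rw [hd] at h1; exact WithBot.coe_le_coe.mp h1
  omega

/-- The polynomials of degree less than `n`. -/
def degreeLT (δ : SkewDerivation σ) (n : ℕ) : Submodule S (SkewPoly δ) where
  carrier := {g | g.degree < (n : WithBot ℕ)}
  zero_mem' := (degree_lt_iff _ n).mpr fun _ _ => rfl
  add_mem' {a b} ha hb := by
    refine (degree_lt_iff _ n).mpr fun i hi => ?_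
    rw [coeff_add, (degree_lt_iff a n).mp ha i hi, (degree_lt_iff b n).mp hb i hi, add_zero]
  smul_mem' c x hx := by
    refine (degree_lt_iff _ n).mpr fun i hi => ?_
    rw [coeff_smul, (degree_lt_iff x n).mp hx i hi, mul_zero]

/-! ### Right division -/

theorem coeff_tMul_succ (g : SkewPoly δ) (i : ℕ) :
    coeff (tMul g) (i + 1) = σ (coeff g i) + δ (coeff g (i + 1)) := by
  let ev : ℕ → SkewPoly δ →+ S := fun i => Finsupp.applyAddHom (M := S) i
  have key : (ev (i + 1)).comp tMul =
      σ.toAddMonoidHom.comp (ev i) + δ.toAddMonoidHom.comp (ev (i + 1)) := by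
    apply addHom_ext
    intro n a
    change coeff (tMul (monomial n a)) (i + 1) =
      σ (coeff (monomial n a : SkewPoly δ) i) + δ (coeff (monomial n a : SkewPoly δ) (i + 1))
    rw [tMul_monomial, coeff_add, coeff_monomial, coeff_monomial, coeff_monomial, coeff_monomial]
    simp only [Nat.add_right_cancel_iff, apply_ite σ, apply_ite δ, map_zero]
  exact DFunLike.congr_fun key g

theorem coeff_tMul_iterate (f : SkewPoly δ) (m : ℕ) (hf : ∀ i, m < i → f.coeff i = 0) (k : ℕ) :
    (∀ i, m + k < i → coeff (tMul^[k] f) i = 0) ∧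
      coeff (tMul^[k] f) (m + k) = σ^[k] (f.coeff m) := by
  induction k with
  | zero => exact ⟨hf, rfl⟩
  | succ k ih =>
    rw [Function.iterate_succ_apply', Function.iterate_succ_apply', ← add_assoc]
    refine ⟨fun i hi => ?_, ?_⟩
    · obtain ⟨j, rfl⟩ : ∃ j, i = j + 1 := ⟨i - 1, by omega⟩
      rw [coeff_tMul_succ, ih.1 j (by omega), ih.1 (j + 1) (by omega), map_zero, map_zero,
        add_zero]
    · rw [coeff_tMul_succ, ih.2, ih.1 (m + k + 1) (by omega), map_zero, add_zero]

theorem isUnit_iterate {a : S} (ha : IsUnit a) (k : ℕ) : IsUnit (σ^[k] a) := by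
  induction k with
  | zero => exact ha
  | succ k ih => rw [Function.iterate_succ_apply']; exact ih.map σ

theorem exists_divMod (f : SkewPoly δ) (hf : IsUnit f.leadingCoeff) (g : SkewPoly δ) :
    ∃ q r : SkewPoly δ, r ∈ degreeLT δ f.natDegree ∧ g = q * f + r := by
  have main : ∀ (n : ℕ) (g : SkewPoly δ), (∀ i, f.natDegree + n ≤ i → g.coeff i = 0) →
      ∃ q r : SkewPoly δ, r ∈ degreeLT δ f.natDegree ∧ g = q * f + r := by
    intro n
    induction n with
    | zero =>
      intro g hg
      exact ⟨0, g, (degree_lt_iff g _).mpr hg, by rw [zero_mul, zero_add]⟩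
    | succ n ih =>
      intro g hg
      obtain ⟨hvan, htop⟩ :=
        coeff_tMul_iterate f f.natDegree (coeff_eq_zero_of_natDegree_lt f) n
      obtain ⟨u, hu⟩ := isUnit_iterate (σ := σ) hf n
      let c : S := g.coeff (f.natDegree + n) * (↑u⁻¹ : S)
      obtain ⟨q, r, hr, hqr⟩ := ih (g - monomial n c * f) (by
        intro i hi
        rw [monomial_mul, coeff_sub, coeff_smul]
        rcases Nat.eq_or_lt_of_le hi with h | h
        · subst h
          rw [htop]
          change _ - _ * σ^[n] f.leadingCoeff = 0
          rw [← hu]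
          simp [c, mul_assoc]
        · rw [hg i (by omega), hvan i h, mul_zero, sub_zero])
      refine ⟨monomial n c + q, r, hr, ?_⟩
      rw [add_mul, add_assoc, ← hqr]
      abel
  refine main (g.natDegree + 1) g fun i hi => coeff_eq_zero_of_natDegree_lt g i (by omega)

theorem eq_zero_of_mul_mem (f : SkewPoly δ) (hf : IsUnit f.leadingCoeff) (q : SkewPoly δ)
    (hq : q * f ∈ degreeLT δ f.natDegree) : q = 0 := by
  have hq' := (degree_lt_iff (q * f) _).mp hq
  have main : ∀ n, (∀ i, n ≤ i → q.coeff i = 0) → q = 0 := by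
    intro n
    induction n with
    | zero => exact fun h => ext fun i => h i (Nat.zero_le i)
    | succ n ih =>
      intro h
      refine ih fun i hi => ?_
      rcases Nat.eq_or_lt_of_le hi with hin | hin
      · subst hin
        have h1 : coeff (q * f) (f.natDegree + n) = q.coeff n * σ^[n] f.leadingCoeff := by
          let ev : SkewPoly δ →+ S := Finsupp.applyAddHom (M := S) (f.natDegree + n)
          have hsum : q * f = (show ℕ →₀ S from q).sum fun k a => monomial k a * f := by
            have := Finsupp.sum_single (show ℕ →₀ S from q)
            have h2 : q = (show ℕ →₀ S from q).sum fun k a => (monomial k a : SkewPoly δ) :=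
              this.symm
            conv_lhs => rw [h2]
            exact map_finsuppSum (leftMul.flip f) (show ℕ →₀ S from q) _
          have h3 : ev (q * f) =
              (show ℕ →₀ S from q).sum fun k a => ev (monomial k a * f) := by
            rw [hsum]
            exact map_finsuppSum ev (show ℕ →₀ S from q) _
          change ev (q * f) = _
          rw [h3, Finsupp.sum, Finset.sum_eq_single n]
          · change coeff (monomial n (q.coeff n) * f) (f.natDegree + n) = _
            rw [monomial_mul, coeff_smul, (coeff_tMul_iterate f f.natDegree
              (coeff_eq_zero_of_natDegree_lt f) n).2]
            rfl
          · intro k hk hkn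
            have hkq : k < n := by
              by_contra hlt
              exact Finsupp.mem_support_iff.mp hk (h k (by omega))
            change coeff (monomial k (q.coeff k) * f) (f.natDegree + n) = _
            rw [monomial_mul, coeff_smul, (coeff_tMul_iterate f f.natDegree
              (coeff_eq_zero_of_natDegree_lt f) k).1 _ (by omega), mul_zero]
          · intro hn
            have hz : q.coeff n = 0 := Finsupp.notMem_support_iff.mp hn
            change coeff (monomial n (q.coeff n) * f) (f.natDegree + n) = _
            rw [hz, map_zero, zero_mul, coeff_zero]
        rw [hq' _ (Nat.le_add_right _ _)] at h1
        exact (isUnit_iterate (σ := σ) hf n).mul_left_eq_zero.mp h1.symm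
      · exact h i hin
  exact main (q.natDegree + 1) fun i hi => coeff_eq_zero_of_natDegree_lt q i (by omega)

/-- Right division by a polynomial `f` with invertible leading coefficient: every `g` has a
unique remainder. -/
theorem existsUnique_mod (f : SkewPoly δ) (hf : IsUnit f.leadingCoeff) (g : SkewPoly δ) :
    ∃! r : SkewPoly δ, r ∈ degreeLT δ f.natDegree ∧ ∃ q : SkewPoly δ, g = q * f + r := by
  obtain ⟨q, r, hr, hqr⟩ := exists_divMod f hf g
  refine ⟨r, ⟨hr, q, hqr⟩, ?_⟩
  rintro r' ⟨hr', q', hqr'⟩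
  have h : (q - q') * f = r' - r := by
    rw [sub_mul, sub_eq_sub_iff_add_eq_add, ← hqr, hqr']
    abel
  have h0 := eq_zero_of_mul_mem f hf (q - q') (h ▸ Submodule.sub_mem _ hr' hr)
  rw [h0, zero_mul] at h
  exact sub_eq_zero.mp h.symm

/-- The remainder `g mod_r f` of right division of `g` by `f`, for `f` with invertible leading
coefficient. -/
def modR (f : SkewPoly δ) (hf : IsUnit f.leadingCoeff) (g : SkewPoly δ) : SkewPoly δ :=
  (existsUnique_mod f hf g).choose

theorem modR_mem (f : SkewPoly δ) (hf : IsUnit f.leadingCoeff) (g : SkewPoly δ) :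
    modR f hf g ∈ degreeLT δ f.natDegree :=
  (existsUnique_mod f hf g).choose_spec.1.1

theorem modR_spec (f : SkewPoly δ) (hf : IsUnit f.leadingCoeff) (g : SkewPoly δ) :
    ∃ q : SkewPoly δ, g = q * f + modR f hf g :=
  (existsUnique_mod f hf g).choose_spec.1.2

end Basic

end SkewPoly

/-! ### The algebras `S_f` -/

/-- The Petit algebra `S_f = S[t; σ, δ] / S[t; σ, δ] f`: the additive group of the skew
polynomials of degree less than `deg f`, for `f` with invertible leading coefficient. -/
def PetitAlgebra {S : Type*} [Ring S] {σ : S →+* S} {δ : SkewDerivation σ} (f : SkewPoly δ)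
    (_hf : IsUnit f.leadingCoeff) : Type _ :=
  SkewPoly.degreeLT δ f.natDegree

namespace PetitAlgebra

section Basic

variable {S : Type*} [Ring S] {σ : S →+* S} {δ : SkewDerivation σ} {f : SkewPoly δ}
  {hf : IsUnit f.leadingCoeff}

instance instAddCommGroup : AddCommGroup (PetitAlgebra f hf) :=
  inferInstanceAs (AddCommGroup (SkewPoly.degreeLT δ f.natDegree))

/-- The left `S`-module structure `a • h = a h`. -/
instance instModule : Module S (PetitAlgebra f hf) :=
  inferInstanceAs (Module S (SkewPoly.degreeLT δ f.natDegree))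

/-- The underlying skew polynomial of degree less than `deg f`. -/
def toPoly (x : PetitAlgebra f hf) : SkewPoly δ :=
  (show SkewPoly.degreeLT δ f.natDegree from x).1

/-- The class of a skew polynomial `g`, represented by `g mod_r f`. -/
def mk (f : SkewPoly δ) (hf : IsUnit f.leadingCoeff) (g : SkewPoly δ) : PetitAlgebra f hf :=
  (⟨SkewPoly.modR f hf g, SkewPoly.modR_mem f hf g⟩ : SkewPoly.degreeLT δ f.natDegree)

/-- The multiplication `g ∘ h = g h mod_r f`. -/
instance instMul : Mul (PetitAlgebra f hf) := ⟨fun x y => mk f hf (x.toPoly * y.toPoly)⟩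

end Basic

/-- The set `S₀ = {a ∈ S | a h = h a for all h ∈ S_f}`, with products taken in `S_f`. -/
def baseSet {S : Type*} [Ring S] {σ : S →+* S} {δ : SkewDerivation σ} (f : SkewPoly δ)
    (hf : IsUnit f.leadingCoeff) : Set S :=
  {a | ∀ h : PetitAlgebra f hf, mk f hf (SkewPoly.C a) * h = h * mk f hf (SkewPoly.C a)}

end PetitAlgebra

/-! ### Nonassociative algebras -/

/-- `A` is a unital, not necessarily associative algebra over the commutative ring `R`: the
multiplication of `A` is `R`-bilinear and has a two-sided unit element. -/
structure IsUnitalNonassocAlgebra (R A : Type*) [CommRing R] [AddCommGroup A] [Module R A]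
    [Mul A] : Prop where
  add_mul : ∀ x y z : A, (x + y) * z = x * z + y * z
  mul_add : ∀ x y z : A, x * (y + z) = x * y + x * z
  smul_mul : ∀ (r : R) (x y : A), (r • x) * y = r • (x * y)
  mul_smul : ∀ (r : R) (x y : A), x * (r • y) = r • (x * y)
  exists_one : ∃ e : A, ∀ x : A, e * x = x ∧ x * e = x

/-- `A` is a semifield: a finite unital nonassociative division ring, that is, a nonzero finite
unital nonassociative ring in which all left and right multiplications by nonzero elements are
bijective. -/
structure IsNonassocSemifield (A : Type*) [AddCommGroup A] [Mul A] : Prop where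
  finite : Finite A
  nontrivial : Nontrivial A
  add_mul : ∀ x y z : A, (x + y) * z = x * z + y * z
  mul_add : ∀ x y z : A, x * (y + z) = x * y + x * z
  exists_one : ∃ e : A, ∀ x : A, e * x = x ∧ x * e = x
  bijective_left : ∀ a : A, a ≠ 0 → Function.Bijective fun x : A => a * x
  bijective_right : ∀ a : A, a ≠ 0 → Function.Bijective fun x : A => x * a

/-- The right nucleus `{x ∈ A | (a b) x = a (b x) for all a, b ∈ A}`. -/
def rightNucleus (A : Type*) [Mul A] : Set A :=
  {x | ∀ a b : A, (a * b) * x = a * (b * x)}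

/-- A multiplicatively closed subset `B` of `A` has no (nontrivial) zero divisors. -/
def HasNoZeroDivisors {A : Type*} [AddCommGroup A] [Mul A] (B : Set A) : Prop :=
  ∀ x ∈ B, ∀ y ∈ B, x * y = 0 → x = 0 ∨ y = 0

/-! ### Reduction modulo the maximal ideal -/

section Reduction

variable {S : Type*} [CommRing S] [IsLocalRing S] {σ : S ≃+* S}

/-- The automorphism of the residue field `K` induced by an automorphism `σ` of the local
ring `S`. -/
def residueMap (σ : S ≃+* S) : IsLocalRing.ResidueField S →+* IsLocalRing.ResidueField S :=
  IsLocalRing.ResidueField.map (σ : S →+* S)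

/-- The additive map of the residue field induced by a `σ`-derivation `δ` which maps the maximal
ideal into itself. -/
def residueAddHom (δ : SkewDerivation (σ : S →+* S))
    (hδ : ∀ a ∈ IsLocalRing.maximalIdeal S, δ a ∈ IsLocalRing.maximalIdeal S) :
    IsLocalRing.ResidueField S →+ IsLocalRing.ResidueField S :=
  QuotientAddGroup.map (IsLocalRing.maximalIdeal S).toAddSubgroup
    (IsLocalRing.maximalIdeal S).toAddSubgroup δ.toAddMonoidHom hδ

theorem residueAddHom_residue (δ : SkewDerivation (σ : S →+* S))
    (hδ : ∀ a ∈ IsLocalRing.maximalIdeal S, δ a ∈ IsLocalRing.maximalIdeal S) (a : S) :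
    residueAddHom δ hδ (IsLocalRing.residue S a) = IsLocalRing.residue S (δ a) := rfl

/-- The derivation of the residue field induced by `δ`. -/
def SkewDerivation.residue (δ : SkewDerivation (σ : S →+* S))
    (hδ : ∀ a ∈ IsLocalRing.maximalIdeal S, δ a ∈ IsLocalRing.maximalIdeal S) :
    SkewDerivation (residueMap σ) where
  toAddMonoidHom := residueAddHom δ hδ
  leibniz x y := by
    obtain ⟨a, rfl⟩ := IsLocalRing.residue_surjective x
    obtain ⟨b, rfl⟩ := IsLocalRing.residue_surjective y
    have h : residueMap σ (IsLocalRing.residue S a) = IsLocalRing.residue S (σ a) := rfl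
    rw [← map_mul, residueAddHom_residue, residueAddHom_residue, residueAddHom_residue, h,
      δ.leibniz, map_add, map_mul, map_mul]
    rfl

namespace SkewPoly

/-- The reduction `f̄ = ∑ āᵢ t ^ i` of `f = ∑ aᵢ t ^ i`, with coefficients in the residue
field. -/
def reduce {δ : SkewDerivation (σ : S →+* S)}
    (hδ : ∀ a ∈ IsLocalRing.maximalIdeal S, δ a ∈ IsLocalRing.maximalIdeal S) (f : SkewPoly δ) :
    SkewPoly (δ.residue hδ) :=
  Finsupp.mapRange (M := S) (N := IsLocalRing.ResidueField S) (IsLocalRing.residue S)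
    (map_zero _) f

/-- A polynomial `f` is base irreducible if its reduction `f̄` is irreducible. -/
def IsBaseIrreducible {δ : SkewDerivation (σ : S →+* S)}
    (hδ : ∀ a ∈ IsLocalRing.maximalIdeal S, δ a ∈ IsLocalRing.maximalIdeal S)
    (f : SkewPoly δ) : Prop :=
  IsIrreducible (f.reduce hδ)

theorem Monic.reduce {δ : SkewDerivation (σ : S →+* S)}
    (hδ : ∀ a ∈ IsLocalRing.maximalIdeal S, δ a ∈ IsLocalRing.maximalIdeal S) {f : SkewPoly δ}
    (hf : f.Monic) : (f.reduce hδ).Monic := by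
  have hc : ∀ i, (f.reduce hδ).coeff i = IsLocalRing.residue S (f.coeff i) := fun i =>
    Finsupp.mapRange_apply (M := S) (N := IsLocalRing.ResidueField S)
      (hf := map_zero (IsLocalRing.residue S)) (g := f) (a := i)
  have hone : (f.reduce hδ).coeff f.natDegree = 1 := by
    rw [hc]
    exact (congrArg _ hf).trans (map_one _)
  have hle : f.natDegree ≤ (f.reduce hδ).natDegree := by
    by_contra hlt
    exact one_ne_zero
      (hone.symm.trans (coeff_eq_zero_of_natDegree_lt _ _ (not_le.mp hlt)))
  have hdeg : (f.reduce hδ).degree < ((f.natDegree + 1 : ℕ) : WithBot ℕ) :=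
    (degree_lt_iff _ _).mpr fun i hi => by
      rw [hc, coeff_eq_zero_of_natDegree_lt f i (by omega), map_zero]
  have hge : (f.reduce hδ).natDegree < f.natDegree + 1 := by
    unfold natDegree
    cases hd : (f.reduce hδ).degree with
    | bot => exact Nat.succ_pos _
    | coe d => rw [hd] at hdeg; exact WithBot.coe_lt_coe.mp hdeg
  have heq : (f.reduce hδ).natDegree = f.natDegree := by omega
  rw [Monic, leadingCoeff, heq, hone]

end SkewPoly

end Reduction

end

/-! Write `R` for the skew polynomial ring. The algebra is `R/Rf` with chosen representatives, and
`Ideal` means left ideal, so `Ideal.span {f}` is `Rf`.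

For (i) and (iii), no reduction modulo `f` occurs when a constant `a` is multiplied with `t`, since
`deg f > 1`. From `ta = σ(a)t + δ(a)`, the set `S₀` consists of the `a` with `σ(a) = a` and `δ(a) =
0` (`mem_baseSet_iff`). Such `a` are central in `R`, and both claims follow.

For (ii), work over the finite residue field `K`, where reduction keeps the degree of the monic `f`.

If `f` is irreducible and `x ∘ y = 0` with `x, y ≠ 0`, then `Rf + Ry = R`, and `r ↦ ry` is a
surjection from `R/Rx` onto `R/Rf`. The first has `|K| ^ deg x` elements and the second `|K| ^ deg
f`, which is more. So there are no zero divisors, and finiteness makes the multiplications bijective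
(`isNonassocSemifield`). A semifield clearly has a right nucleus without zero divisors.

The substance is that such a right nucleus forces irreducibility
(`isIrreducible_of_hasNoZeroDivisors`). The nucleus contains the class of each `g` with `fg ∈ Rf`;
being finite without zero divisors, it makes these classes zero or invertible. Let `f = gh` be a
proper factorization. Derivations of finite fields are inner, so a shift `s = t + c` of the variable
satisfies `sa = σ(a)s`, and some power of `s` is central. By the nucleus hypothesis, `s` acts
injectively on `R/Rf`. The annihilator `J` of the submodule generated by `h` is then a nonzero
two-sided ideal whose monic element `p` of least degree is central (`commute_of_minimal`). As `hp =
ph ∈ Rf` and `h ∉ Rf`, the class of `p` is not invertible, so `p = yf = fy`. By degree `y ∉ J`, so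
`yuh ∉ Rf` for some `u`. But `f(yuh) = puh ∈ Rf`, so `yuh` is invertible modulo `Rf ⊆ Rh`. Hence `1
∈ Rh`, contradicting `deg h > 0`. -/

noncomputable section

/-! ### Coefficients and degrees over an arbitrary ring -/

namespace SkewPoly

section Ring

variable {S : Type*} [Ring S] {σ : S →+* S} {δ : SkewDerivation σ}

/-- Taking the coefficient of `t ^ i`, as an additive map. -/
def coeffHom (i : ℕ) : SkewPoly δ →+ S where
  toFun g := g.coeff i
  map_zero' := rfl
  map_add' _ _ := rfl

theorem coeff_sum {ι : Type*} (s : Finset ι) (F : ι → SkewPoly δ) (i : ℕ) :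
    coeff (∑ k ∈ s, F k) i = ∑ k ∈ s, coeff (F k) i :=
  map_sum (coeffHom i) F s

theorem coeff_C (a : S) (i : ℕ) : coeff (C a : SkewPoly δ) i = if 0 = i then a else 0 :=
  coeff_monomial 0 i a

theorem C_mul (a : S) (g : SkewPoly δ) : C a * g = a • g :=
  monomial_mul 0 a g

theorem C_add (a b : S) : (C (a + b) : SkewPoly δ) = C a + C b := map_add (monomial 0) a b

theorem C_sub (a b : S) : (C (a - b) : SkewPoly δ) = C a - C b := map_sub (monomial 0) a b

theorem C_zero : (C 0 : SkewPoly δ) = 0 := map_zero (monomial 0)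

theorem C_one : (C 1 : SkewPoly δ) = 1 := rfl

theorem C_mul_C (a b : S) : (C a * C b : SkewPoly δ) = C (a * b) := by
  rw [C_mul]; exact smul_monomial 0 a b

theorem C_injective : Function.Injective (C : S → SkewPoly δ) := fun a b h => by
  have := congrArg (fun g : SkewPoly δ => g.coeff 0) h
  simpa [coeff_C] using this

theorem eq_sum_monomial (g : SkewPoly δ) (n : ℕ) (hg : ∀ i, n ≤ i → g.coeff i = 0) :
    g = ∑ k ∈ Finset.range n, monomial k (g.coeff k) := by
  apply ext
  intro i
  rw [coeff_sum]
  simp only [coeff_monomial]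
  rw [Finset.sum_ite_eq']
  split_ifs with h
  · rfl
  · exact hg i (by simpa using h)

/-- Multiplying by `t ^ k` on the left raises a degree bound by `k` and applies `σ^[k]` to the top
coefficient. Stated with bounds instead of degrees, this needs nothing about zero divisors or
vanishing top coefficients. -/
theorem coeff_mul_of_bounds (g h : SkewPoly δ) (n m : ℕ) (hg : ∀ i, n < i → g.coeff i = 0)
    (hh : ∀ i, m < i → h.coeff i = 0) :
    (∀ i, n + m < i → (g * h).coeff i = 0) ∧
      (g * h).coeff (n + m) = g.coeff n * σ^[n] (h.coeff m) := by
  have key : ∀ i, (g * h).coeff i =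
      ∑ k ∈ Finset.range (n + 1), g.coeff k * coeff (tMul^[k] h) i := by
    intro i
    conv_lhs => rw [eq_sum_monomial g (n + 1) hg, Finset.sum_mul, coeff_sum]
    exact Finset.sum_congr rfl fun k _ => by rw [monomial_mul, coeff_smul]
  refine ⟨fun i hi => ?_, ?_⟩
  · rw [key]
    refine Finset.sum_eq_zero fun k hk => ?_
    rw [Finset.mem_range] at hk
    rw [(coeff_tMul_iterate h m hh k).1 i (by omega), mul_zero]
  · rw [key, Finset.sum_range_succ, add_comm n m, (coeff_tMul_iterate h m hh n).2,
      Finset.sum_eq_zero, zero_add]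
    intro k hk
    rw [Finset.mem_range] at hk
    rw [(coeff_tMul_iterate h m hh k).1 _ (by omega), mul_zero]

theorem mem_degreeLT_iff (g : SkewPoly δ) (n : ℕ) :
    g ∈ degreeLT δ n ↔ ∀ i, n ≤ i → g.coeff i = 0 :=
  degree_lt_iff g n

theorem leadingCoeff_ne_zero {g : SkewPoly δ} (hg : g ≠ 0) : g.leadingCoeff ≠ 0 := by
  intro h0
  refine hg (ext fun i => ?_)
  have key : ∀ n, (∀ i, n ≤ i → g.coeff i = 0) → ∀ i, g.coeff i = 0 := by
    intro n
    induction n with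
    | zero => exact fun h i => h i (Nat.zero_le i)
    | succ n ih =>
      intro hn
      refine ih fun i hi => ?_
      rcases Nat.eq_or_lt_of_le hi with rfl | hi
      · by_contra hne
        have h1 : g.natDegree = n := by
          apply le_antisymm
          · have : g.degree < ((n + 1 : ℕ) : WithBot ℕ) := (degree_lt_iff g _).mpr hn
            unfold natDegree
            cases hd : g.degree with
            | bot => exact Nat.zero_le n
            | coe d => rw [hd] at this; exact Nat.lt_succ_iff.mp (WithBot.coe_lt_coe.mp this)
          · by_contra hlt
            exact hne (coeff_eq_zero_of_natDegree_lt g _ (not_le.mp hlt))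
        exact hne (h1 ▸ h0)
      · exact hn i hi
  exact key (g.natDegree + 1) (fun i hi => coeff_eq_zero_of_natDegree_lt g i hi) i

theorem natDegree_eq_of_coeff {g : SkewPoly δ} {n : ℕ} (hg : ∀ i, n < i → g.coeff i = 0)
    (hn : g.coeff n ≠ 0) : g.natDegree = n := by
  have hne : g ≠ 0 := by rintro rfl; exact hn rfl
  apply le_antisymm
  · by_contra hlt
    exact leadingCoeff_ne_zero hne (hg _ (not_le.mp hlt))
  · by_contra hlt
    exact hn (coeff_eq_zero_of_natDegree_lt g _ (not_le.mp hlt))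

theorem natDegree_lt_of_mem {g : SkewPoly δ} {n : ℕ} (hg : g ∈ degreeLT δ n) (h0 : g ≠ 0) :
    g.natDegree < n := by
  by_contra hlt
  exact leadingCoeff_ne_zero h0 ((mem_degreeLT_iff g n).mp hg _ (not_lt.mp hlt))

theorem mem_degreeLT_of_natDegree_lt {g : SkewPoly δ} {n : ℕ} (hg : g.natDegree < n) :
    g ∈ degreeLT δ n :=
  (mem_degreeLT_iff g n).mpr fun i hi => coeff_eq_zero_of_natDegree_lt g i (hg.trans_le hi)

theorem C_mem_degreeLT (a : S) {n : ℕ} (hn : 0 < n) : (C a : SkewPoly δ) ∈ degreeLT δ n :=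
  (mem_degreeLT_iff _ n).mpr fun i hi => by rw [coeff_C, if_neg (by omega)]

theorem one_mem_degreeLT {n : ℕ} (hn : 0 < n) : (1 : SkewPoly δ) ∈ degreeLT δ n :=
  C_mem_degreeLT 1 hn

theorem t_mem_degreeLT {n : ℕ} (hn : 1 < n) : (t : SkewPoly δ) ∈ degreeLT δ n :=
  (mem_degreeLT_iff _ n).mpr fun i hi => by
    rw [t, coeff_monomial, if_neg (by omega)]

/-- A polynomial of degree less than `n` is the sequence of its first `n` coefficients. -/
def degreeLTEquiv (δ : SkewDerivation σ) (n : ℕ) : degreeLT δ n ≃ (Fin n → S) where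
  toFun g i := coeff g.1 i
  invFun v := ⟨∑ i : Fin n, monomial i (v i), Submodule.sum_mem _ fun i _ =>
    (mem_degreeLT_iff _ n).mpr fun j hj => by rw [coeff_monomial, if_neg (by omega)]⟩
  left_inv g := by
    apply Subtype.ext
    change ∑ i : Fin n, monomial (i : ℕ) (coeff g.1 i) = g.1
    conv_rhs => rw [eq_sum_monomial g.1 n ((mem_degreeLT_iff g.1 n).mp g.2)]
    exact Fin.sum_univ_eq_sum_range (fun i => (monomial i (coeff g.1 i) : SkewPoly δ)) n
  right_inv v := by
    funext j
    change coeff (∑ i : Fin n, (monomial (i : ℕ) (v i) : SkewPoly δ)) j = v j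
    rw [coeff_sum]
    simp [coeff_monomial, Fin.val_inj]

end Ring

end SkewPoly

/-! ### Arithmetic modulo the left ideal `Rf` -/

namespace PetitAlgebra

open SkewPoly

section Ring

variable {S : Type*} [Ring S] {σ : S →+* S} {δ : SkewDerivation σ} {f : SkewPoly δ}
  {hf : IsUnit f.leadingCoeff}

theorem finite [Finite S] : Finite (PetitAlgebra f hf) :=
  Finite.of_equiv _ (degreeLTEquiv δ f.natDegree).symm

/-- The count behind the absence of zero divisors for irreducible `f`. -/
theorem card [Finite S] : Nat.card (PetitAlgebra f hf) = Nat.card S ^ f.natDegree := by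
  rw [← Nat.card_fin f.natDegree, ← Nat.card_fun]
  exact Nat.card_congr (degreeLTEquiv δ f.natDegree)

theorem toPoly_mem (x : PetitAlgebra f hf) : x.toPoly ∈ degreeLT δ f.natDegree := x.2

theorem toPoly_injective : Function.Injective (toPoly : PetitAlgebra f hf → SkewPoly δ) :=
  Subtype.val_injective

theorem toPoly_zero : (0 : PetitAlgebra f hf).toPoly = 0 := rfl

theorem toPoly_add (x y : PetitAlgebra f hf) : (x + y).toPoly = x.toPoly + y.toPoly := rfl

theorem toPoly_smul (a : S) (x : PetitAlgebra f hf) : (a • x).toPoly = a • x.toPoly := rfl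

theorem mul_def (x y : PetitAlgebra f hf) : x * y = mk f hf (x.toPoly * y.toPoly) := rfl

theorem sub_toPoly_mk_mem (g : SkewPoly δ) : g - (mk f hf g).toPoly ∈ Ideal.span {f} := by
  obtain ⟨q, hq⟩ := modR_spec f hf g
  refine Ideal.mem_span_singleton'.mpr ⟨q, ?_⟩
  change _ = g - modR f hf g
  rw [eq_sub_iff_add_eq]
  exact hq.symm

theorem eq_zero_of_mem_span {g : SkewPoly δ} (hf : IsUnit f.leadingCoeff)
    (hg : g ∈ degreeLT δ f.natDegree) (h : g ∈ Ideal.span {f}) : g = 0 := by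
  obtain ⟨q, rfl⟩ := Ideal.mem_span_singleton'.mp h
  rw [eq_zero_of_mul_mem f hf q hg, zero_mul]

theorem toPoly_mk_eq {g r : SkewPoly δ} (hr : r ∈ degreeLT δ f.natDegree)
    (h : g - r ∈ Ideal.span {f}) : (mk f hf g).toPoly = r := by
  refine sub_eq_zero.mp (eq_zero_of_mem_span hf (Submodule.sub_mem _ (toPoly_mem _) hr) ?_)
  have := Ideal.sub_mem _ h (sub_toPoly_mk_mem (hf := hf) g)
  rwa [sub_sub_sub_cancel_left] at this

theorem mk_eq_mk {g h : SkewPoly δ} : mk f hf g = mk f hf h ↔ g - h ∈ Ideal.span {f} := by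
  constructor
  · intro H
    have := Ideal.sub_mem _ (sub_toPoly_mk_mem (hf := hf) g) (sub_toPoly_mk_mem (hf := hf) h)
    rwa [H, sub_sub_sub_cancel_right] at this
  · intro H
    refine toPoly_injective (toPoly_mk_eq (toPoly_mem _) ?_)
    have := Ideal.add_mem _ H (sub_toPoly_mk_mem (hf := hf) h)
    rwa [sub_add_sub_cancel] at this

theorem toPoly_mk_of_mem {g : SkewPoly δ} (hg : g ∈ degreeLT δ f.natDegree) :
    (mk f hf g).toPoly = g :=
  toPoly_mk_eq hg (by rw [sub_self]; exact Ideal.zero_mem _)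

theorem mk_toPoly (x : PetitAlgebra f hf) : mk f hf x.toPoly = x :=
  toPoly_injective (toPoly_mk_of_mem (toPoly_mem x))

theorem mk_zero : mk f hf 0 = 0 := mk_toPoly 0

theorem mk_eq_zero {g : SkewPoly δ} : mk f hf g = 0 ↔ g ∈ Ideal.span {f} := by
  rw [← mk_zero, mk_eq_mk, sub_zero]

theorem mk_add (g h : SkewPoly δ) : mk f hf (g + h) = mk f hf g + mk f hf h := by
  refine toPoly_injective (toPoly_mk_eq (toPoly_mem _) ?_)
  rw [toPoly_add, add_sub_add_comm]
  exact Ideal.add_mem _ (sub_toPoly_mk_mem g) (sub_toPoly_mk_mem h)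

theorem mk_smul (a : S) (g : SkewPoly δ) : mk f hf (a • g) = a • mk f hf g := by
  refine toPoly_injective (toPoly_mk_eq (toPoly_mem _) ?_)
  rw [toPoly_smul, ← smul_sub, ← C_mul]
  exact Ideal.mul_mem_left _ _ (sub_toPoly_mk_mem g)

/-- Reducing the right factor is always harmless because `Rf` is a left ideal; reducing the left
factor is not. -/
theorem mul_mk (x : PetitAlgebra f hf) (g : SkewPoly δ) :
    x * mk f hf g = mk f hf (x.toPoly * g) := by
  rw [mul_def, eq_comm, mk_eq_mk, ← mul_sub]
  exact Ideal.mul_mem_left _ _ (sub_toPoly_mk_mem g)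

/-- `f g ∈ R f` makes right multiplication by `g` compatible with reduction modulo `R f`. -/
theorem mk_mul_mk {g : SkewPoly δ} (hg : f * g ∈ Ideal.span {f}) (h : SkewPoly δ) :
    mk f hf h * mk f hf g = mk f hf (h * g) := by
  rw [mul_mk, eq_comm, mk_eq_mk, ← sub_mul]
  obtain ⟨q, hq⟩ := Ideal.mem_span_singleton'.mp (sub_toPoly_mk_mem (hf := hf) h)
  rw [← hq, mul_assoc]
  exact Ideal.mul_mem_left _ _ hg

/-- For such `g`, right multiplication by `g` descends to an endomorphism of the left module `R/Rf`,
so associativity in `R` passes to the quotient. -/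
theorem mk_mem_rightNucleus {g : SkewPoly δ} (hg : f * g ∈ Ideal.span {f}) :
    mk f hf g ∈ rightNucleus (PetitAlgebra f hf) := by
  intro a b
  rw [mul_def a b, mk_mul_mk hg, mul_mk b, mul_mk, mul_assoc]

theorem add_mul (x y z : PetitAlgebra f hf) : (x + y) * z = x * z + y * z := by
  rw [mul_def, toPoly_add, _root_.add_mul, mk_add]; rfl

theorem mul_add (x y z : PetitAlgebra f hf) : x * (y + z) = x * y + x * z := by
  rw [mul_def, toPoly_add, _root_.mul_add, mk_add]; rfl

theorem smul_mul (a : S) (x y : PetitAlgebra f hf) : (a • x) * y = a • (x * y) := by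
  rw [mul_def, toPoly_smul, SkewPoly.smul_mul', mk_smul]; rfl

theorem zero_mul (x : PetitAlgebra f hf) : 0 * x = 0 := by
  rw [mul_def, toPoly_zero, MulZeroClass.zero_mul, mk_zero]

theorem mul_zero (x : PetitAlgebra f hf) : x * 0 = 0 := by
  rw [mul_def, toPoly_zero, MulZeroClass.mul_zero, mk_zero]

theorem sub_mul (x y z : PetitAlgebra f hf) : (x - y) * z = x * z - y * z := by
  rw [eq_sub_iff_add_eq, ← add_mul, sub_add_cancel]

theorem mul_sub (x y z : PetitAlgebra f hf) : x * (y - z) = x * y - x * z := by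
  rw [eq_sub_iff_add_eq, ← mul_add, sub_add_cancel]

theorem mul_mk_one (x : PetitAlgebra f hf) : x * mk f hf 1 = x := by
  rw [mul_mk, mul_one, mk_toPoly]

theorem mk_one_mul (hm : 0 < f.natDegree) (x : PetitAlgebra f hf) : mk f hf 1 * x = x := by
  rw [mul_def, toPoly_mk_of_mem (one_mem_degreeLT hm), one_mul, mk_toPoly]

end Ring

/-! ### The base ring `S₀` -/

section CommRing

variable {S : Type*} [CommRing S] {σ : S →+* S} {δ : SkewDerivation σ} {f : SkewPoly δ}
  {hf : IsUnit f.leadingCoeff}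

theorem commute_C {a : S} (hσ : σ a = a) (hδ : δ a = 0) (g : SkewPoly δ) :
    C a * g = g * C a := by
  have iter : ∀ n : ℕ, tMul^[n] (C a : SkewPoly δ) = monomial n a := by
    intro n
    induction n with
    | zero => rfl
    | succ n ih => rw [Function.iterate_succ_apply', ih, tMul_monomial, hσ, hδ, map_zero, add_zero]
  have key : AddMonoidHom.mulLeft (C a : SkewPoly δ) = AddMonoidHom.mulRight (C a) := by
    apply addHom_ext
    intro n b
    change C a * monomial n b = monomial n b * C a
    rw [C_mul, monomial_mul, iter, smul_monomial, smul_monomial, mul_comm]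
  exact DFunLike.congr_fun key g

/-- Commuting with `t` already gives both conditions: `ta` and `at` have degree at most one, below
`deg f`, so their coefficients can be compared directly. Conversely the two conditions make `a`
central in `R`. -/
theorem mem_baseSet_iff (hm : 1 < f.natDegree) (a : S) :
    a ∈ baseSet f hf ↔ σ a = a ∧ δ a = 0 := by
  constructor
  · intro ha
    have h1 := ha (mk f hf t)
    rw [mul_def, mul_def, toPoly_mk_of_mem (C_mem_degreeLT a (by omega)),
      toPoly_mk_of_mem (t_mem_degreeLT hm), mk_eq_mk] at h1
    have h2 := eq_zero_of_mem_span hf ((mem_degreeLT_iff _ _).mpr fun i hi => ?_) h1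
    · rw [sub_eq_zero, t_mul_C, C_mul] at h2
      have hc : ∀ i, _ := fun i => congrArg (fun g : SkewPoly δ => g.coeff i) h2
      have hc0 := hc 0
      have hc1 := hc 1
      simp only [C_mul, coeff_add, coeff_smul, coeff_C, t, coeff_monomial] at hc0 hc1
      exact ⟨by simpa using hc1.symm, by simpa using hc0.symm⟩
    · rw [t_mul_C, C_mul, C_mul, coeff_sub, coeff_add, coeff_smul, coeff_smul, coeff_C, t,
        coeff_monomial, if_neg (by omega), if_neg (by omega)]
      simp
  · rintro ⟨hσ, hδ⟩ h
    rw [mul_def, mul_def, toPoly_mk_of_mem (C_mem_degreeLT a (by omega)), commute_C hσ hδ]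

theorem mul_smul_of_mem {a : S} (hm : 1 < f.natDegree) (ha : a ∈ baseSet f hf)
    (x y : PetitAlgebra f hf) : x * (a • y) = a • (x * y) := by
  obtain ⟨hσ, hδ⟩ := (mem_baseSet_iff hm a).mp ha
  rw [mul_def, toPoly_smul, ← C_mul, ← mul_assoc, ← commute_C hσ hδ, mul_assoc, C_mul, mk_smul]
  rfl

/-- The subring `S₀` of `S`. -/
def baseSubring (f : SkewPoly δ) (hf : IsUnit f.leadingCoeff) (hm : 1 < f.natDegree) :
    Subring S where
  carrier := baseSet f hf
  mul_mem' {a b} ha hb := by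
    rw [mem_baseSet_iff hm] at ha hb ⊢
    rw [map_mul, δ.leibniz, ha.1, hb.1, ha.2, hb.2]
    simp
  one_mem' := (mem_baseSet_iff hm 1).mpr ⟨map_one σ, by simpa using δ.leibniz 1 1⟩
  add_mem' {a b} ha hb := by
    rw [mem_baseSet_iff hm] at ha hb ⊢
    rw [map_add, map_add, ha.1, hb.1, ha.2, hb.2, add_zero]
    exact ⟨rfl, rfl⟩
  zero_mem' := (mem_baseSet_iff hm 0).mpr ⟨map_zero σ, map_zero _⟩
  neg_mem' {a} ha := by
    rw [mem_baseSet_iff hm] at ha ⊢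
    rw [map_neg, map_neg, ha.1, ha.2, neg_zero]
    exact ⟨rfl, rfl⟩

theorem isUnitalNonassocAlgebra (hm : 1 < f.natDegree) :
    IsUnitalNonassocAlgebra (baseSubring f hf hm) (PetitAlgebra f hf) where
  add_mul := add_mul
  mul_add := mul_add
  smul_mul r := smul_mul (r : S)
  mul_smul r := mul_smul_of_mem hm r.2
  exists_one := ⟨mk f hf 1, fun x => ⟨mk_one_mul (by omega) x, mul_mk_one x⟩⟩

end CommRing

end PetitAlgebra

/-! ### Skew polynomials over a field: degrees and left ideals -/

namespace SkewPoly

section Field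

variable {K : Type*} [Field K] {σ : K →+* K} {δ : SkewDerivation σ}

theorem coeff_mul_natDegree_add (g h : SkewPoly δ) :
    (g * h).coeff (g.natDegree + h.natDegree) =
      g.leadingCoeff * σ^[g.natDegree] h.leadingCoeff :=
  (coeff_mul_of_bounds g h _ _ (coeff_eq_zero_of_natDegree_lt g)
    (coeff_eq_zero_of_natDegree_lt h)).2

theorem leadingCoeff_mul_iterate_ne_zero {g h : SkewPoly δ} (hg : g ≠ 0) (hh : h ≠ 0) :
    g.leadingCoeff * σ^[g.natDegree] h.leadingCoeff ≠ 0 :=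
  mul_ne_zero (leadingCoeff_ne_zero hg)
    (isUnit_iterate (leadingCoeff_ne_zero hh).isUnit _).ne_zero

theorem natDegree_mul {g h : SkewPoly δ} (hg : g ≠ 0) (hh : h ≠ 0) :
    (g * h).natDegree = g.natDegree + h.natDegree := by
  refine natDegree_eq_of_coeff (coeff_mul_of_bounds g h _ _ (coeff_eq_zero_of_natDegree_lt g)
    (coeff_eq_zero_of_natDegree_lt h)).1 ?_
  rw [coeff_mul_natDegree_add]
  exact leadingCoeff_mul_iterate_ne_zero hg hh

instance instNoZeroDivisors : NoZeroDivisors (SkewPoly δ) where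
  eq_zero_or_eq_zero_of_mul_eq_zero {g h} H := by
    by_contra! hne
    apply leadingCoeff_mul_iterate_ne_zero hne.1 hne.2
    rw [← coeff_mul_natDegree_add, H, coeff_zero]

instance instNontrivial : Nontrivial (SkewPoly δ) :=
  ⟨0, 1, fun h => zero_ne_one (C_injective (δ := δ) (C_zero.trans h))⟩

instance instIsDomain : IsDomain (SkewPoly δ) := NoZeroDivisors.to_isDomain _

theorem natDegree_C (a : K) : (C a : SkewPoly δ).natDegree = 0 := by
  by_contra h
  have := leadingCoeff_ne_zero (g := (C a : SkewPoly δ)) (by rintro h0; rw [h0] at h; exact h rfl)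
  rw [leadingCoeff, coeff_C, if_neg (Ne.symm h)] at this
  exact this rfl

theorem eq_C_of_natDegree_eq_zero {g : SkewPoly δ} (h : g.natDegree = 0) :
    g = C (g.coeff 0) := by
  refine ext fun i => ?_
  rw [coeff_C]
  split_ifs with hi
  · rw [hi]
  · exact coeff_eq_zero_of_natDegree_lt g i (by omega)

theorem C_ne_zero {a : K} (ha : a ≠ 0) : (C a : SkewPoly δ) ≠ 0 := fun h =>
  ha (C_injective (δ := δ) (h.trans C_zero.symm))

theorem C_inv_mul_C {a : K} (ha : a ≠ 0) : (C a⁻¹ * C a : SkewPoly δ) = 1 := by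
  rw [C_mul_C, inv_mul_cancel₀ ha, C_one]

theorem natDegree_C_mul {a : K} (ha : a ≠ 0) (g : SkewPoly δ) :
    (C a * g).natDegree = g.natDegree := by
  rcases eq_or_ne g 0 with rfl | hg
  · rw [mul_zero]
  · rw [natDegree_mul (C_ne_zero ha) hg, natDegree_C, zero_add]

/-- A nonzero left ideal contains a monic polynomial of minimal degree. -/
theorem exists_monic_minimal {I : Ideal (SkewPoly δ)} {g : SkewPoly δ} (hg : g ∈ I)
    (hg0 : g ≠ 0) : ∃ p ∈ I, p.Monic ∧ ∀ h ∈ I, h ∈ degreeLT δ p.natDegree → h = 0 := by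
  classical
  have hex : ∃ n, ∃ p ∈ I, p ≠ 0 ∧ p.natDegree = n := ⟨_, g, hg, hg0, rfl⟩
  obtain ⟨p, hpI, hp0, hpn⟩ := Nat.find_spec hex
  have hlc := leadingCoeff_ne_zero hp0
  have hdeg := natDegree_C_mul (δ := δ) (inv_ne_zero hlc) p
  refine ⟨C p.leadingCoeff⁻¹ * p, I.mul_mem_left _ hpI, ?_, fun h hhI hh => ?_⟩
  · rw [Monic, leadingCoeff, hdeg, C_mul, coeff_smul]
    exact inv_mul_cancel₀ hlc
  · by_contra hh0
    refine Nat.find_min hex (m := h.natDegree) ?_ ⟨h, hhI, hh0, rfl⟩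
    rw [← hpn, ← hdeg]
    exact natDegree_lt_of_mem hh hh0

theorem Monic.ne_zero {p : SkewPoly δ} (hp : p.Monic) : p ≠ 0 := by
  rintro rfl
  exact zero_ne_one (α := K) hp

/-- A polynomial of minimal degree in a left ideal divides its elements on the right. -/
theorem mem_span_of_minimal {I : Ideal (SkewPoly δ)} {p : SkewPoly δ} (hpI : p ∈ I)
    (hp : p ≠ 0) (hmin : ∀ h ∈ I, h ∈ degreeLT δ p.natDegree → h = 0) {h : SkewPoly δ}
    (hh : h ∈ I) : h ∈ Ideal.span {p} := by
  obtain ⟨q, r, hr, hqr⟩ := exists_divMod p (leadingCoeff_ne_zero hp).isUnit h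
  have hrI : r ∈ I := by
    rw [eq_sub_of_add_eq' hqr.symm]
    exact I.sub_mem hh (I.mul_mem_left _ hpI)
  rw [hmin r hrI hr, add_zero] at hqr
  exact Ideal.mem_span_singleton'.mpr ⟨q, hqr.symm⟩

theorem degree_lt_degree_of_natDegree_lt {g f : SkewPoly δ} (h : g.natDegree < f.natDegree) :
    g.degree < f.degree := by
  have h1 : g.degree < (f.natDegree : WithBot ℕ) :=
    (degree_lt_iff _ _).mpr fun i hi => coeff_eq_zero_of_natDegree_lt g i (h.trans_le hi)
  refine h1.trans_le ?_
  unfold natDegree at *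
  cases hd : f.degree with
  | bot => rw [hd] at h; exact absurd h (Nat.not_lt_zero _)
  | coe d => exact le_rfl

theorem natDegree_lt_of_degree_lt {g f : SkewPoly δ} (h : g.degree < f.degree) (hg : g ≠ 0) :
    g.natDegree < f.natDegree := by
  refine natDegree_lt_of_mem ?_ hg
  change g.degree < (f.natDegree : WithBot ℕ)
  refine h.trans_le ?_
  unfold natDegree
  cases hd : f.degree with
  | bot => exact bot_le
  | coe d => exact le_rfl

/-- A left ideal that properly contains the one generated by an irreducible polynomial is
everything. -/
theorem eq_top_of_isIrreducible {f : SkewPoly δ} (hf : f.IsIrreducible) (hm : 0 < f.natDegree)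
    {I : Ideal (SkewPoly δ)} (hfI : f ∈ I) {h : SkewPoly δ} (hh : h ∈ I) (hh0 : h ≠ 0)
    (hdeg : h.natDegree < f.natDegree) : I = ⊤ := by
  obtain ⟨p, hpI, hpm, hmin⟩ := exists_monic_minimal hh hh0
  have hp0 := hpm.ne_zero
  obtain ⟨q, hq⟩ := Ideal.mem_span_singleton'.mp (mem_span_of_minimal hpI hp0 hmin hfI)
  have hf0 : f ≠ 0 := by rintro rfl; exact absurd hm (Nat.lt_irrefl 0)
  have hq0 : q ≠ 0 := by rintro rfl; exact hf0 (by rw [← hq, zero_mul])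
  have hsum := natDegree_mul hq0 hp0
  rw [hq] at hsum
  have hpd : p.natDegree < f.natDegree := by
    refine lt_of_le_of_lt ?_ hdeg
    by_contra hlt
    exact hh0 (hmin h hh (mem_degreeLT_of_natDegree_lt (not_le.mp hlt)))
  -- Degrees add in `f = q * p`, so positive degree of `p` would make `q` a proper factor too.
  have hpz : p.natDegree = 0 := by
    by_contra hpz
    exact hf.2 ⟨q, p, degree_lt_degree_of_natDegree_lt (by omega),
      degree_lt_degree_of_natDegree_lt hpd, hq.symm⟩
  rw [Ideal.eq_top_iff_one]
  have : p = 1 := by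
    rw [eq_C_of_natDegree_eq_zero hpz, ← C_one]
    congr 1
    rw [← hpz]
    exact hpm
  rwa [← this]

theorem not_isUnit_of_natDegree_pos {f : SkewPoly δ} (hm : 0 < f.natDegree) : ¬ IsUnit f := by
  rintro ⟨u, rfl⟩
  have h := natDegree_mul (g := (u : SkewPoly δ)) (h := ↑u⁻¹) u.ne_zero u⁻¹.ne_zero
  rw [u.mul_inv, ← C_one, natDegree_C] at h
  omega

end Field

end SkewPoly

/-! ### Irreducible polynomials give semifields -/

namespace PetitAlgebra

open SkewPoly

section Field

variable {K : Type*} [Field K] {σ : K →+* K} {δ : SkewDerivation σ} {f : SkewPoly δ}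
  {hf : IsUnit f.leadingCoeff}

theorem eq_zero_or_eq_zero_of_isIrreducible [Finite K] (hirr : f.IsIrreducible)
    (hm : 0 < f.natDegree) {x y : PetitAlgebra f hf} (hxy : x * y = 0) : x = 0 ∨ y = 0 := by
  by_contra! hne
  obtain ⟨hx, hy⟩ := hne
  have hx0 : x.toPoly ≠ 0 := fun h => hx (toPoly_injective h)
  have hy0 : y.toPoly ≠ 0 := fun h => hy (toPoly_injective h)
  have hxd := natDegree_lt_of_mem (toPoly_mem x) hx0
  have hyd := natDegree_lt_of_mem (toPoly_mem y) hy0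
  have hxu := (leadingCoeff_ne_zero hx0).isUnit
  have htop := eq_top_of_isIrreducible hirr hm (I := Ideal.span {f, y.toPoly})
    (Ideal.subset_span (by simp)) (Ideal.subset_span (by simp)) hy0 hyd
  -- The map `R/Rx → R/Rf`, `r ↦ ry`. Write a target as `af + by` and divide `b = qx + r`; since `xy
  -- ∈ Rf`, `ry` and `by` agree modulo `Rf`.
  have hsurj : Function.Surjective fun r : PetitAlgebra x.toPoly hxu =>
      mk f hf (r.toPoly * y.toPoly) := by
    intro u
    have hu : u.toPoly ∈ Ideal.span {f, y.toPoly} := htop ▸ Submodule.mem_top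
    obtain ⟨a, b, hab⟩ := Submodule.mem_span_pair.mp hu
    obtain ⟨q, hq⟩ := Ideal.mem_span_singleton'.mp (sub_toPoly_mk_mem (hf := hxu) b)
    refine ⟨mk x.toPoly hxu b, ?_⟩
    change mk f hf _ = u
    rw [← mk_toPoly u, mk_eq_mk, ← hab]
    have hxy' : x.toPoly * y.toPoly ∈ Ideal.span {f} := mk_eq_zero.mp hxy
    have hf' : f ∈ Ideal.span {f} := Ideal.subset_span rfl
    have : (mk x.toPoly hxu b).toPoly * y.toPoly - (a • f + b • y.toPoly) =
        -(a * f + q * (x.toPoly * y.toPoly)) := by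
      rw [← mul_assoc, hq, smul_eq_mul, smul_eq_mul]
      noncomm_ring
    rw [this]
    exact Ideal.neg_mem_iff _ |>.mpr
      (Ideal.add_mem _ (Ideal.mul_mem_left _ _ hf') (Ideal.mul_mem_left _ _ hxy'))
  have : Finite (PetitAlgebra x.toPoly hxu) := finite
  have hcard := Nat.card_le_card_of_surjective _ hsurj
  rw [card, card] at hcard
  exact absurd hcard (not_le.mpr (Nat.pow_lt_pow_right Finite.one_lt_card hxd))

theorem isNonassocSemifield [Finite K] (hirr : f.IsIrreducible) (hm : 0 < f.natDegree) :
    IsNonassocSemifield (PetitAlgebra f hf) where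
  finite := finite
  nontrivial := by
    refine ⟨mk f hf 1, 0, fun h => one_ne_zero (α := SkewPoly δ) ?_⟩
    exact eq_zero_of_mem_span hf (one_mem_degreeLT hm) (mk_eq_zero.mp h)
  add_mul := add_mul
  mul_add := mul_add
  exists_one := ⟨mk f hf 1, fun x => ⟨mk_one_mul hm x, mul_mk_one x⟩⟩
  bijective_left a ha := by
    have : Finite (PetitAlgebra f hf) := finite
    refine Finite.injective_iff_bijective.mp fun x y hxy => sub_eq_zero.mp ?_
    refine (eq_zero_or_eq_zero_of_isIrreducible hirr hm ?_).resolve_left ha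
    rw [mul_sub, sub_eq_zero]
    exact hxy
  bijective_right a ha := by
    have : Finite (PetitAlgebra f hf) := finite
    refine Finite.injective_iff_bijective.mp fun x y hxy => sub_eq_zero.mp ?_
    refine (eq_zero_or_eq_zero_of_isIrreducible hirr hm ?_).resolve_right ha
    rw [sub_mul, sub_eq_zero]
    exact hxy

theorem hasNoZeroDivisors_of_isNonassocSemifield (h : IsNonassocSemifield (PetitAlgebra f hf)) :
    HasNoZeroDivisors (rightNucleus (PetitAlgebra f hf)) := by
  intro x _ y _ hxy
  by_contra! hne
  exact hne.2 ((h.bijective_left x hne.1).injective (hxy.trans (mul_zero x).symm))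

end Field

/-! ### Invertibility in the right nucleus -/

section RightNucleus

variable {K : Type*} [Field K] {σ : K →+* K} {δ : SkewDerivation σ} {f : SkewPoly δ}
  {hf : IsUnit f.leadingCoeff}

theorem mul_mem_rightNucleus {A : Type*} [Mul A] {x y : A} (hx : x ∈ rightNucleus A)
    (hy : y ∈ rightNucleus A) : x * y ∈ rightNucleus A := fun a b => by
  rw [← hy, hx, hy, hy]

/-- If the right nucleus has no zero divisors, its nonzero elements are invertible in it. -/
theorem exists_inverse [Finite K]
    (hE : HasNoZeroDivisors (rightNucleus (PetitAlgebra f hf)))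
    {x : PetitAlgebra f hf} (hx : x ∈ rightNucleus (PetitAlgebra f hf)) (hx0 : x ≠ 0) :
    (∃ y ∈ rightNucleus (PetitAlgebra f hf), x * y = mk f hf 1) ∧
      ∃ y ∈ rightNucleus (PetitAlgebra f hf), y * x = mk f hf 1 := by
  have : Finite (PetitAlgebra f hf) := finite
  have h1 : mk f hf 1 ∈ rightNucleus (PetitAlgebra f hf) := fun a b => by
    rw [mul_mk_one, mul_mk_one]
  have hsub : ∀ a ∈ rightNucleus (PetitAlgebra f hf), ∀ b ∈ rightNucleus (PetitAlgebra f hf),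
      a - b ∈ rightNucleus (PetitAlgebra f hf) := fun a ha b hb c d => by
    rw [mul_sub, mul_sub, mul_sub, ha, hb]
  have hl : Function.Injective fun y : rightNucleus (PetitAlgebra f hf) =>
      (⟨x * y.1, mul_mem_rightNucleus hx y.2⟩ : rightNucleus (PetitAlgebra f hf)) := by
    intro y z hyz
    refine Subtype.ext (sub_eq_zero.mp ((hE x hx _ (hsub _ y.2 _ z.2) ?_).resolve_left hx0))
    rw [mul_sub, sub_eq_zero]
    exact congrArg Subtype.val hyz
  have hr : Function.Injective fun y : rightNucleus (PetitAlgebra f hf) =>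
      (⟨y.1 * x, mul_mem_rightNucleus y.2 hx⟩ : rightNucleus (PetitAlgebra f hf)) := by
    intro y z hyz
    refine Subtype.ext (sub_eq_zero.mp ((hE _ (hsub _ y.2 _ z.2) x hx ?_).resolve_right hx0))
    rw [sub_mul, sub_eq_zero]
    exact congrArg Subtype.val hyz
  obtain ⟨y, hy⟩ := Finite.surjective_of_injective hl ⟨_, h1⟩
  obtain ⟨z, hz⟩ := Finite.surjective_of_injective hr ⟨_, h1⟩
  exact ⟨⟨y, y.2, congrArg Subtype.val hy⟩, ⟨z, z.2, congrArg Subtype.val hz⟩⟩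

/-- If the right nucleus has no zero divisors, right multiplication by an element of it which
is not in `R f` is injective modulo `R f`. -/
theorem mem_span_of_mul_mem_span [Finite K]
    (hE : HasNoZeroDivisors (rightNucleus (PetitAlgebra f hf))) {g h : SkewPoly δ}
    (hg : f * g ∈ Ideal.span {f}) (hh : h ∉ Ideal.span {f}) (hhg : h * g ∈ Ideal.span {f}) :
    g ∈ Ideal.span {f} := by
  by_contra hg0
  obtain ⟨⟨y, hy, hxy⟩, -⟩ := exists_inverse hE (mk_mem_rightNucleus hg)
    (fun h0 => hg0 (mk_eq_zero.mp h0))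
  have h1 : mk f hf h = 0 := by
    -- With `y` the inverse of `g`: `h = h ∘ (g ∘ y) = (h ∘ g) ∘ y = 0`, where reassociation is
    -- allowed because `y` is in the right nucleus.
    rw [← mul_mk_one (mk f hf h), ← hxy, ← hy, mk_mul_mk hg, mk_eq_zero.mpr hhg, zero_mul]
  exact hh (mk_eq_zero.mp h1)

/-- If the right nucleus has no zero divisors, an element of it which is not in `R f` generates
the left module `R / R f`. -/
theorem exists_mul_sub_one_mem_span [Finite K]
    (hE : HasNoZeroDivisors (rightNucleus (PetitAlgebra f hf))) {g : SkewPoly δ}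
    (hg : f * g ∈ Ideal.span {f}) (hg0 : g ∉ Ideal.span {f}) :
    ∃ y, y * g - 1 ∈ Ideal.span {f} := by
  obtain ⟨-, y, -, hy⟩ := exists_inverse hE (mk_mem_rightNucleus hg)
    (fun h0 => hg0 (mk_eq_zero.mp h0))
  rw [← mk_toPoly y, mk_mul_mk hg, mk_eq_mk] at hy
  exact ⟨_, hy⟩

end RightNucleus

end PetitAlgebra

/-! ### Removing the derivation over a finite field -/

namespace SkewPoly

section Field

variable {K : Type*} [Field K] {σ : K →+* K} {δ : SkewDerivation σ}

/-- A skew derivation of a finite field is inner. -/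
theorem exists_inner [Finite K] (δ : SkewDerivation σ) : ∃ c : K, ∀ a, δ a = c * (σ a - a) := by
  by_cases h : ∃ b, σ b ≠ b
  · obtain ⟨b, hb⟩ := h
    have hb' : σ b - b ≠ 0 := sub_ne_zero.mpr hb
    -- Expanding `δ (a * b) = δ (b * a)` gives `δ a * (σ b - b) = δ b * (σ a - a)`.
    refine ⟨δ b / (σ b - b), fun a => ?_⟩
    have h1 := δ.leibniz a b
    have h2 := δ.leibniz b a
    rw [mul_comm b a, h1] at h2
    field_simp
    linear_combination -h2
  · push Not at h
    -- Here `σ` is the identity and `δ` an ordinary derivation. It vanishes because `a = a ^ |K|`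
    -- and `|K|` is zero in `K`.
    have hpow : ∀ (a : K) (n : ℕ), δ (a ^ (n + 1)) = (n + 1) * a ^ n * δ a := by
      intro a n
      induction n with
      | zero => simp
      | succ n ih =>
        rw [pow_succ, δ.leibniz, ih, h]
        push_cast
        ring
    refine ⟨0, fun a => ?_⟩
    have : Fintype K := Fintype.ofFinite K
    obtain ⟨n, hn⟩ : ∃ n, Fintype.card K = n + 1 :=
      Nat.exists_eq_succ_of_ne_zero Fintype.card_ne_zero
    have h1 := hpow a n
    have h2 : ((n : K) + 1) = 0 := by
      exact_mod_cast (congrArg (Nat.cast : ℕ → K) hn).symm.trans (FiniteField.cast_card_eq_zero K)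
    rw [← hn, FiniteField.pow_card, h2] at h1
    simpa using h1

theorem coeff_t_add_C (c : K) (i : ℕ) :
    (t + C c : SkewPoly δ).coeff i = (if 1 = i then 1 else 0) + if 0 = i then c else 0 := by
  rw [coeff_add, coeff_C, t, coeff_monomial]

/-- A monic `s` of degree one with `s a = σ(a) s` for all constants `a`, so that the skew
polynomial ring is `K[s; σ]`. -/
structure IsHomogenizer (s : SkewPoly δ) : Prop where
  natDegree : s.natDegree = 1
  monic : s.Monic
  mul_C : ∀ a, s * C a = C (σ a) * s

theorem exists_isHomogenizer [Finite K] (δ : SkewDerivation σ) :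
    ∃ s : SkewPoly δ, IsHomogenizer s := by
  obtain ⟨c, hc⟩ := exists_inner δ
  have hdeg : (t + C c : SkewPoly δ).natDegree = 1 :=
    natDegree_eq_of_coeff (fun i hi => by
      rw [coeff_t_add_C, if_neg (by omega), if_neg (by omega), add_zero])
      (by rw [coeff_t_add_C]; simp)
  -- If `δ a = c * (σ a - a)`, then `(t + c)a = σ(a)t + δ(a) + ca = σ(a)(t + c)`.
  refine ⟨t + C c, hdeg, ?_, fun a => ?_⟩
  · rw [Monic, leadingCoeff, hdeg, coeff_t_add_C]
    simp
  · rw [add_mul, mul_add, t_mul_C, add_assoc, C_mul_C, C_mul_C, ← C_add, hc]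
    congr 2
    ring

/-! ### The normal element `s` and central polynomials -/

namespace IsHomogenizer

variable {s : SkewPoly δ} (hs : IsHomogenizer s)
include hs

theorem ne_zero : s ≠ 0 := hs.monic.ne_zero

theorem exists_eq_mul_add_C (g : SkewPoly δ) : ∃ q a, g = q * s + C a := by
  obtain ⟨q, r, hr, hqr⟩ := exists_divMod s hs.monic.isUnit g
  refine ⟨q, r.coeff 0, ?_⟩
  rw [hs.natDegree, mem_degreeLT_iff] at hr
  rw [← eq_C_of_natDegree_eq_zero]
  · exact hqr
  · by_contra hne
    refine leadingCoeff_ne_zero (g := r) ?_ (hr _ (by omega))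
    rintro rfl
    exact hne rfl

/-- Horner's scheme in `s`: each right division by `s` lowers the degree and leaves a constant. -/
theorem induction_on {P : SkewPoly δ → Prop} (hC : ∀ a, P (C a))
    (hstep : ∀ g a, P g → P (g * s + C a)) (g : SkewPoly δ) : P g := by
  have main : ∀ n, ∀ g : SkewPoly δ, g.natDegree ≤ n → P g := by
    intro n
    induction n with
    | zero =>
      intro g hg
      rw [eq_C_of_natDegree_eq_zero (Nat.le_zero.mp hg)]
      exact hC _
    | succ n ih =>
      intro g hg
      obtain ⟨q, a, hqa⟩ := hs.exists_eq_mul_add_C g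
      rw [hqa]
      refine hstep q a (ih q ?_)
      rcases eq_or_ne q 0 with rfl | hq
      · exact Nat.zero_le n
      · by_contra hlt
        have hqs : g - C a = q * s := by rw [hqa, add_sub_cancel_right]
        have h1 := natDegree_mul hq hs.ne_zero
        rw [hs.natDegree, ← hqs] at h1
        have h2 : g - C a ∈ degreeLT δ (n + 2) := Submodule.sub_mem _
          (mem_degreeLT_of_natDegree_lt (by omega)) (C_mem_degreeLT a (by omega))
        have h3 := natDegree_lt_of_mem h2 (hqs ▸ mul_ne_zero hq hs.ne_zero)
        omega
  exact main _ g le_rfl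

theorem exists_mul_eq (g : SkewPoly δ) : ∃ g', s * g = g' * s := by
  refine hs.induction_on (P := fun g => ∃ g', s * g = g' * s) (fun a => ⟨_, hs.mul_C a⟩)
    (fun g a ⟨g', hg'⟩ => ⟨g' * s + C (σ a), ?_⟩) g
  rw [mul_add, ← mul_assoc, hg', hs.mul_C, add_mul]

/-- With `exists_mul_eq` this gives `Rs = sR`. This half moves constants through `s` backwards and
so needs `σ` surjective, which finiteness of `K` supplies. -/
theorem exists_eq_mul [Finite K] (g : SkewPoly δ) : ∃ g', g * s = s * g' := by
  have hσ : Function.Surjective σ := Finite.surjective_of_injective σ.injective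
  refine hs.induction_on (P := fun g => ∃ g', g * s = s * g') (fun a => ?_)
    (fun g a ⟨g', hg'⟩ => ?_) g
  · obtain ⟨b, rfl⟩ := hσ a
    exact ⟨_, (hs.mul_C b).symm⟩
  · obtain ⟨b, rfl⟩ := hσ a
    exact ⟨g' * s + C b, by rw [add_mul, hg', ← hs.mul_C, mul_assoc, ← mul_add]⟩

theorem commute_of_commute {z : SkewPoly δ} (hzC : ∀ a, z * C a = C a * z) (hzs : z * s = s * z)
    (g : SkewPoly δ) : z * g = g * z := by
  refine hs.induction_on (P := fun g => z * g = g * z) hzC (fun g a hg => ?_) g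
  rw [mul_add, add_mul, hzC, ← mul_assoc, hg, mul_assoc, hzs, mul_assoc]

/-- Makes the constant term of the expansion in `s` well defined; later arguments compare constant
terms this way. -/
theorem eq_zero_of_C_eq_mul {a : K} {q : SkewPoly δ} (h : C a = q * s) : a = 0 := by
  by_contra ha
  have hq : q ≠ 0 := by
    rintro rfl
    exact C_ne_zero ha (h.trans (zero_mul s))
  have h1 := natDegree_mul hq hs.ne_zero
  rw [← h, natDegree_C, hs.natDegree] at h1
  omega

theorem natDegree_pow (n : ℕ) : (s ^ n).natDegree = n := by
  induction n with
  | zero => rw [pow_zero, ← C_one, natDegree_C]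
  | succ n ih => rw [pow_succ, natDegree_mul (pow_ne_zero n hs.ne_zero) hs.ne_zero, ih,
      hs.natDegree]

theorem pow_mul_C (n : ℕ) (a : K) : s ^ n * C a = C (σ^[n] a) * s ^ n := by
  induction n with
  | zero => rw [pow_zero, one_mul, mul_one]; rfl
  | succ n ih =>
    rw [pow_succ', mul_assoc, ih, ← mul_assoc, hs.mul_C, mul_assoc, Function.iterate_succ_apply']

/-- Moving a constant past `s ^ n` applies `σ^[n]`, so the order of `σ` as a permutation of `K`
serves as `n`. -/
theorem exists_central_pow [Finite K] : ∃ n, 0 < n ∧ ∀ g, s ^ n * g = g * s ^ n := by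
  let e : Equiv.Perm K := Equiv.ofBijective σ (Finite.injective_iff_bijective.mp σ.injective)
  refine ⟨orderOf e, orderOf_pos e, hs.commute_of_commute (fun a => ?_) ?_⟩
  · rw [hs.pow_mul_C]
    have h1 : σ^[orderOf e] = ⇑(e ^ orderOf e) := (Equiv.Perm.iterate_eq_pow e _)
    rw [h1, pow_orderOf_eq_one]
    rfl
  · rw [← pow_succ, ← pow_succ']

/-- The right divisors of the powers of `s` are powers of `s`, up to constants. -/
theorem eq_C_mul_pow_of_mul_eq_pow [Finite K] (n : ℕ) :
    ∀ q f : SkewPoly δ, q * f = s ^ n → ∃ b k, f = C b * s ^ k := by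
  induction n with
  | zero =>
    intro q f h
    rw [pow_zero] at h
    have hq : q ≠ 0 := by rintro rfl; rw [zero_mul] at h; exact zero_ne_one h
    have hf : f ≠ 0 := by rintro rfl; rw [mul_zero] at h; exact zero_ne_one h
    have h1 := natDegree_mul hq hf
    rw [h, ← C_one, natDegree_C] at h1
    exact ⟨f.coeff 0, 0, by rw [pow_zero, mul_one]; exact eq_C_of_natDegree_eq_zero (by omega)⟩
  | succ n ih =>
    intro q f h
    obtain ⟨q', b, rfl⟩ := hs.exists_eq_mul_add_C q
    obtain ⟨f', a, rfl⟩ := hs.exists_eq_mul_add_C f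
    obtain ⟨g', hg'⟩ := hs.exists_mul_eq (f' * s + C a)
    -- The constant term in `s` of the product is `b * a`, whereas `s ^ (n + 1)` has none. So one
    -- factor is a multiple of `s`, which can be cancelled.
    have hba : b * a = 0 := by
      refine hs.eq_zero_of_C_eq_mul (q := s ^ n - q' * g' - C b * f') ?_
      rw [sub_mul, sub_mul, ← pow_succ, ← h, ← C_mul_C, add_mul, mul_assoc q' s, hg']
      noncomm_ring
    rcases mul_eq_zero.mp hba with rfl | rfl
    · rw [C_zero, add_zero] at h
      obtain ⟨q'', hq''⟩ := hs.exists_eq_mul q'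
      refine ih q'' _ (mul_left_cancel₀ hs.ne_zero ?_)
      rw [← mul_assoc, ← hq'', h, pow_succ']
    · rw [C_zero, add_zero] at h ⊢
      obtain ⟨c, k, rfl⟩ := ih _ f' (mul_right_cancel₀ hs.ne_zero (by
        rw [mul_assoc, h, pow_succ]))
      exact ⟨c, k + 1, by rw [pow_succ, mul_assoc]⟩

/-- A monic element of minimal degree of a two-sided ideal on which `s` is cancellable is
central. -/
theorem commute_of_minimal [Finite K] {J : Ideal (SkewPoly δ)} [J.IsTwoSided]
    (hJs : ∀ g, s * g ∈ J → g ∈ J) {p : SkewPoly δ} (hpJ : p ∈ J) (hp : p.Monic)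
    (hmin : ∀ h ∈ J, h ∈ degreeLT δ p.natDegree → h = 0) (g : SkewPoly δ) : p * g = g * p := by
  have hpd := coeff_eq_zero_of_natDegree_lt p
  have hsd : ∀ i, 1 < i → s.coeff i = 0 := fun i hi =>
    coeff_eq_zero_of_natDegree_lt s i (hs.natDegree ▸ hi)
  have hp1 : p.coeff p.natDegree = 1 := hp
  have hs1 : s.coeff 1 = 1 := by
    have := hs.monic
    rwa [Monic, leadingCoeff, hs.natDegree] at this
  -- The difference of the two sides lies in `J` and its leading terms cancel, so minimality makes
  -- it zero.
  have hpC : ∀ a, p * C a = C (σ^[p.natDegree] a) * p := by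
    intro a
    refine sub_eq_zero.mp (hmin _ (J.sub_mem (J.mul_mem_right _ hpJ) (J.mul_mem_left _ hpJ)) ?_)
    refine (mem_degreeLT_iff _ _).mpr fun i hi => ?_
    have h1 := coeff_mul_of_bounds p (C a) _ 0 hpd
      (fun i hi => by rw [coeff_C, if_neg (by omega)])
    rw [add_zero, coeff_C, if_pos rfl, hp1, one_mul] at h1
    rw [coeff_sub, C_mul, coeff_smul]
    rcases Nat.eq_or_lt_of_le hi with rfl | hi
    · rw [h1.2, hp1, mul_one, sub_self]
    · rw [h1.1 i hi, hpd i hi, mul_zero, sub_self]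
  obtain ⟨p', p₀, hpp⟩ := hs.exists_eq_mul_add_C p
  -- Otherwise `p = s * p''`, and cancelling `s` puts `p''`, of smaller degree, in `J`.
  have hp₀ : p₀ ≠ 0 := by
    rintro rfl
    rw [C_zero, add_zero] at hpp
    obtain ⟨p'', hp''⟩ := hs.exists_eq_mul p'
    rw [hp''] at hpp
    have h0 : p'' ≠ 0 := by
      rintro rfl
      exact hp.ne_zero (hpp.trans (mul_zero s))
    have h1 := natDegree_mul hs.ne_zero h0
    rw [← hpp, hs.natDegree] at h1
    exact h0 (hmin _ (hJs _ (hpp ▸ hpJ)) (mem_degreeLT_of_natDegree_lt (by omega)))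
  -- Compare constant terms in `s` in `hpC` and divide by `p₀`.
  have hσ : ∀ a, σ^[p.natDegree] a = a := by
    intro a
    have h1 : p₀ * a - σ^[p.natDegree] a * p₀ = 0 := by
      refine hs.eq_zero_of_C_eq_mul (q := C (σ^[p.natDegree] a) * p' - p' * C (σ a)) ?_
      have h2 := hpC a
      conv at h2 => lhs; rw [hpp, add_mul, mul_assoc, hs.mul_C, C_mul_C]
      conv at h2 => rhs; rhs; rw [hpp]
      rw [mul_add, C_mul_C] at h2
      rw [C_sub, sub_mul, sub_eq_sub_iff_add_eq_add, mul_assoc, mul_assoc, ← h2, add_comm]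
    have h3 : p₀ * (a - σ^[p.natDegree] a) = 0 := by rw [← h1]; ring
    exact (sub_eq_zero.mp ((mul_eq_zero.mp h3).resolve_left hp₀)).symm
  refine hs.commute_of_commute (fun a => by rw [hpC, hσ]) ?_ g
  have h1 := coeff_mul_of_bounds s p 1 _ hsd hpd
  have h2 := coeff_mul_of_bounds p s _ 1 hpd hsd
  -- The terms of degree `deg p + 1` cancel since `p` and `s` are monic, so the commutator is a
  -- constant multiple of `p` by minimality. It has constant term zero in `s` while `p₀ ≠ 0`, so
  -- that constant vanishes.
  have h3 : s * p - p * s = C ((s * p - p * s).coeff p.natDegree) * p := by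
    refine sub_eq_zero.mp (hmin _ (J.sub_mem (J.sub_mem (J.mul_mem_left _ hpJ)
      (J.mul_mem_right _ hpJ)) (J.mul_mem_left _ hpJ)) ?_)
    refine (mem_degreeLT_iff _ _).mpr fun i hi => ?_
    rw [coeff_sub, C_mul, coeff_smul]
    rcases Nat.eq_or_lt_of_le hi with rfl | hi
    · rw [hp1, mul_one, sub_self]
    · rw [hpd i hi, mul_zero, sub_zero, coeff_sub]
      rcases Nat.eq_or_lt_of_le (Nat.succ_le_of_lt hi) with rfl | hi
      · rw [h2.2, Nat.succ_eq_add_one, add_comm, h1.2, hp1, hs1, one_mul, one_mul, hσ,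
          Function.iterate_one, map_one, sub_self]
      · rw [h1.1 i (by omega), h2.1 i (by omega), sub_self]
  obtain ⟨g', hg'⟩ := hs.exists_mul_eq p
  have hk : (s * p - p * s).coeff p.natDegree * p₀ = 0 := by
    refine hs.eq_zero_of_C_eq_mul
      (q := g' - p - C ((s * p - p * s).coeff p.natDegree) * p') ?_
    generalize (s * p - p * s).coeff p.natDegree = k at h3 ⊢
    conv at h3 => rhs; rhs; rw [hpp]
    rw [mul_add, C_mul_C] at h3
    rw [sub_mul, sub_mul, ← hg', h3, mul_assoc, add_sub_cancel_left]
  rw [(mul_eq_zero.mp hk).resolve_right hp₀, C_zero, zero_mul] at h3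
  exact (sub_eq_zero.mp h3).symm

end IsHomogenizer

end Field

end SkewPoly

/-! ### A right nucleus without zero divisors forces irreducibility -/

namespace PetitAlgebra

open SkewPoly

section Field

variable {K : Type*} [Field K] {σ : K →+* K} {δ : SkewDerivation σ} {f : SkewPoly δ}
  {hf : IsUnit f.leadingCoeff}

/-- The annihilator of the submodule of `R / R f` generated by `h`. -/
def annihilator (f h : SkewPoly δ) : Ideal (SkewPoly δ) where
  carrier := {r | ∀ u, r * u * h ∈ Ideal.span {f}}
  add_mem' {a b} ha hb u := by
    rw [_root_.add_mul, _root_.add_mul]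
    exact Ideal.add_mem _ (ha u) (hb u)
  zero_mem' u := by
    rw [MulZeroClass.zero_mul, MulZeroClass.zero_mul]
    exact Ideal.zero_mem _
  smul_mem' c x hx u := by
    rw [smul_eq_mul, mul_assoc, mul_assoc, ← mul_assoc x]
    exact Ideal.mul_mem_left _ _ (hx u)

theorem mem_annihilator {f h r : SkewPoly δ} :
    r ∈ annihilator f h ↔ ∀ u, r * u * h ∈ Ideal.span {f} := Iff.rfl

instance annihilator_isTwoSided (f h : SkewPoly δ) : (annihilator f h).IsTwoSided where
  mul_mem_of_left {a} b ha u := by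
    rw [mul_assoc a]
    exact ha (b * u)

theorem not_mem_span_of_natDegree_lt {f h : SkewPoly δ} (h0 : h ≠ 0)
    (hdeg : h.natDegree < f.natDegree) : h ∉ Ideal.span {f} := fun hmem => by
  have hf0 : f ≠ 0 := by rintro rfl; exact absurd hdeg (Nat.not_lt_zero _)
  exact h0 (eq_zero_of_mem_span (leadingCoeff_ne_zero hf0).isUnit
    (mem_degreeLT_of_natDegree_lt hdeg) hmem)

/-- By pigeonhole, two powers of a central `s ^ n` agree in the finite quotient `R/Rf`. Their
difference is central and lies in `Rf`, so it annihilates all of `R/Rf`; it is nonzero because the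
degrees differ. -/
theorem exists_mem_annihilator [Finite K] {s : SkewPoly δ} (hs : IsHomogenizer s)
    (hf : IsUnit f.leadingCoeff) (h : SkewPoly δ) : ∃ p ∈ annihilator f h, p ≠ 0 := by
  obtain ⟨n, hn, hz⟩ := hs.exists_central_pow
  have : Finite (PetitAlgebra f hf) := finite
  obtain ⟨i, j, hij, heq⟩ := Finite.exists_ne_map_eq_of_infinite
    fun i : ℕ => mk f hf ((s ^ n) ^ i)
  have hzi : ∀ (i : ℕ) (g : SkewPoly δ), (s ^ n) ^ i * g = g * (s ^ n) ^ i := fun i g =>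
    Commute.pow_left (hz g) i
  refine ⟨(s ^ n) ^ i - (s ^ n) ^ j, fun u => ?_, fun h0 => hij ?_⟩
  · rw [mul_assoc, _root_.sub_mul, hzi, hzi, ← _root_.mul_sub]
    exact Ideal.mul_mem_left _ _ (mk_eq_mk.mp heq)
  · have h1 := congrArg natDegree (sub_eq_zero.mp h0)
    rw [← pow_mul, ← pow_mul, hs.natDegree_pow, hs.natDegree_pow] at h1
    exact Nat.eq_of_mul_eq_mul_left hn h1

/-- If `s` kills a nonzero class, so does a central power of `s`, which is then in `Rf` by the
nucleus hypothesis. Hence `f` is a constant times `s ^ k` with `k > 1`. Then `s` itself has its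
class in the nucleus and satisfies `s ^ (k - 1) * s ∈ Rf`, forcing `s ∈ Rf` against its degree. -/
theorem isHomogenizer_mul_injective [Finite K] {s : SkewPoly δ} (hs : IsHomogenizer s)
    (hm : 1 < f.natDegree) (hE : HasNoZeroDivisors (rightNucleus (PetitAlgebra f hf)))
    {v : SkewPoly δ} (hv : s * v ∈ Ideal.span {f}) : v ∈ Ideal.span {f} := by
  by_contra hv0
  obtain ⟨n, hn, hz⟩ := hs.exists_central_pow
  have hzf : s ^ n ∈ Ideal.span {f} := by
    refine mem_span_of_mul_mem_span hE ?_ hv0 ?_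
    · rw [← hz]
      exact Ideal.mul_mem_left _ _ (Ideal.subset_span rfl)
    · obtain ⟨k, rfl⟩ := Nat.exists_eq_succ_of_ne_zero hn.ne'
      rw [← hz, pow_succ, mul_assoc]
      exact Ideal.mul_mem_left _ _ hv
  obtain ⟨q, hq⟩ := Ideal.mem_span_singleton'.mp hzf
  obtain ⟨b, k, hbk⟩ := hs.eq_C_mul_pow_of_mul_eq_pow n q f hq
  have hb : b ≠ 0 := by
    rintro rfl
    rw [hbk, C_zero, MulZeroClass.zero_mul] at hm
    exact absurd hm (Nat.not_lt_zero _)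
  have hk : f.natDegree = k := by rw [hbk, natDegree_C_mul hb, hs.natDegree_pow]
  have hsk : s ^ k = C b⁻¹ * f := by rw [hbk, ← mul_assoc, C_inv_mul_C hb, one_mul]
  obtain ⟨j, rfl⟩ : ∃ j, k = j + 1 := ⟨k - 1, by omega⟩
  have hff : f ∈ Ideal.span {f} := Ideal.subset_span rfl
  refine not_mem_span_of_natDegree_lt hs.ne_zero (by rw [hs.natDegree]; exact hm)
    (mem_span_of_mul_mem_span hE ?_ (h := s ^ j) ?_ ?_)
  -- From `f = b s ^ k`: `f s = b s s ^ k`, and `s ^ k = b⁻¹ f`.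
  · have : f * s = C b * s * C b⁻¹ * f := by
      rw [mul_assoc (C b * s), ← hsk, mul_assoc, ← pow_succ']
      conv_lhs => rw [hbk]
      rw [mul_assoc, ← pow_succ]
    rw [this]
    exact Ideal.mul_mem_left _ _ hff
  · exact not_mem_span_of_natDegree_lt (pow_ne_zero _ hs.ne_zero)
      (by rw [hs.natDegree_pow]; omega)
  · rw [← pow_succ, hsk]
    exact Ideal.mul_mem_left _ _ hff

theorem isIrreducible_of_hasNoZeroDivisors [Finite K] (hm : 1 < f.natDegree)
    (hE : HasNoZeroDivisors (rightNucleus (PetitAlgebra f hf))) : f.IsIrreducible := by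
  refine ⟨not_isUnit_of_natDegree_pos (by omega), ?_⟩
  rintro ⟨g, h, hg, hh, hfgh⟩
  have hf0 : f ≠ 0 := by rintro rfl; exact absurd hm (Nat.not_lt_zero _)
  have hg0 : g ≠ 0 := by rintro rfl; exact hf0 (hfgh.trans (MulZeroClass.zero_mul h))
  have hh0 : h ≠ 0 := by rintro rfl; exact hf0 (hfgh.trans (MulZeroClass.mul_zero g))
  have hgd := natDegree_lt_of_degree_lt hg hg0
  have hhd := natDegree_lt_of_degree_lt hh hh0
  have hsum := natDegree_mul hg0 hh0
  rw [← hfgh] at hsum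
  have hff : f ∈ Ideal.span {f} := Ideal.subset_span rfl
  obtain ⟨s, hs⟩ := exists_isHomogenizer δ
  obtain ⟨a, haJ, ha0⟩ := exists_mem_annihilator hs hf h
  obtain ⟨p, hpJ, hp, hmin⟩ := exists_monic_minimal haJ ha0
  have hcomm := hs.commute_of_minimal (J := annihilator f h) (fun r hr u =>
    isHomogenizer_mul_injective hs hm hE (by
      rw [← mul_assoc, ← mul_assoc]; exact hr u)) hpJ hp hmin
  have hpf : p ∈ Ideal.span {f} := by
    refine mem_span_of_mul_mem_span hE ?_ (not_mem_span_of_natDegree_lt hh0 hhd) ?_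
    · rw [← hcomm]
      exact Ideal.mul_mem_left _ _ hff
    · rw [← hcomm, ← mul_one p]
      exact hpJ 1
  obtain ⟨y, hy⟩ := Ideal.mem_span_singleton'.mp hpf
  have hy0 : y ≠ 0 := by rintro rfl; exact hp.ne_zero (hy.symm.trans (MulZeroClass.zero_mul f))
  -- Centrality of `p` gives `y(fy) = py = yp`; cancel `y`.
  have hfy : f * y = p := mul_left_cancel₀ hy0 (by rw [← mul_assoc, hy, hcomm])
  have hyJ : y ∉ annihilator f h := fun hyJ => by
    have hyd := natDegree_mul hy0 hf0
    rw [hy] at hyd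
    exact hy0 (hmin y hyJ (mem_degreeLT_of_natDegree_lt (by omega)))
  rw [mem_annihilator] at hyJ
  push Not at hyJ
  obtain ⟨u, hu⟩ := hyJ
  obtain ⟨x, hx⟩ := exists_mul_sub_one_mem_span hE (g := y * u * h) (by
    rw [← mul_assoc, ← mul_assoc, hfy]; exact hpJ u) hu
  obtain ⟨q, hq⟩ := Ideal.mem_span_singleton'.mp hx
  -- Substituting `f = gh` turns `x(yuh) - qf = 1` into a left inverse of `h`.
  have hunit : (x * (y * u) - q * g) * h = 1 := by
    rw [_root_.sub_mul, mul_assoc q, ← hfgh, hq, mul_assoc x]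
    abel
  have h0 : x * (y * u) - q * g ≠ 0 := by
    intro h0
    rw [h0, MulZeroClass.zero_mul] at hunit
    exact zero_ne_one hunit
  have := natDegree_mul h0 hh0
  rw [hunit, ← C_one, natDegree_C] at this
  omega

end Field

end PetitAlgebra

/-! ### Reduction to the residue field and the theorem -/

namespace SkewPoly

theorem Monic.natDegree_reduce {S : Type*} [CommRing S] [IsLocalRing S] {σ : S ≃+* S}
    {δ : SkewDerivation (σ : S →+* S)}
    {hδ : ∀ a ∈ IsLocalRing.maximalIdeal S, δ a ∈ IsLocalRing.maximalIdeal S} {f : SkewPoly δ}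
    (hf : f.Monic) : (f.reduce hδ).natDegree = f.natDegree := by
  have hc : ∀ i, (f.reduce hδ).coeff i = IsLocalRing.residue S (f.coeff i) := fun i =>
    Finsupp.mapRange_apply (M := S) (N := IsLocalRing.ResidueField S)
      (hf := map_zero (IsLocalRing.residue S)) (g := f) (a := i)
  refine natDegree_eq_of_coeff (fun i hi => ?_) ?_
  · rw [hc, coeff_eq_zero_of_natDegree_lt f i hi, map_zero]
  · rw [hc, show f.coeff f.natDegree = 1 from hf, map_one]
    exact one_ne_zero

end SkewPoly

end

theorem mainTheorem10 {S : Type*} [CommRing S] [IsFiniteChainRing S] (σ : S ≃+* S)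
    (δ : SkewDerivation (σ : S →+* S))
    (hδ : ∀ a ∈ IsLocalRing.maximalIdeal S, δ a ∈ IsLocalRing.maximalIdeal S)
    (f : SkewPoly δ) (hf : f.Monic) (hm : 1 < f.natDegree) :
    (∃ S₀ : Subring S, (S₀ : Set S) = PetitAlgebra.baseSet f hf.isUnit ∧
      IsUnitalNonassocAlgebra S₀ (PetitAlgebra f hf.isUnit) ∧
      Finite (PetitAlgebra f hf.isUnit)) ∧
    ((IsNonassocSemifield (PetitAlgebra (f.reduce hδ) (hf.reduce hδ).isUnit) ↔
        f.IsBaseIrreducible hδ) ∧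
      (f.IsBaseIrreducible hδ ↔
        HasNoZeroDivisors
          (rightNucleus (PetitAlgebra (f.reduce hδ) (hf.reduce hδ).isUnit)))) ∧
    ((∀ a : S, δ a = 0) → {a : S | σ a = a} ⊆ PetitAlgebra.baseSet f hf.isUnit) := by
  have hS : Finite S := IsFiniteChainRing.finite
  have hK : Finite (IsLocalRing.ResidueField S) :=
    Finite.of_surjective _ IsLocalRing.residue_surjective
  have hm' : 1 < (f.reduce hδ).natDegree := by rwa [hf.natDegree_reduce]
  refine ⟨⟨PetitAlgebra.baseSubring f hf.isUnit hm, rfl,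
    PetitAlgebra.isUnitalNonassocAlgebra hm, PetitAlgebra.finite⟩, ⟨⟨fun h => ?_, fun h => ?_⟩,
    ⟨fun h => ?_, fun h => ?_⟩⟩, fun h a ha => ?_⟩
  -- Even from a semifield, irreducibility is obtained through the right nucleus.
  · exact PetitAlgebra.isIrreducible_of_hasNoZeroDivisors hm'
      (PetitAlgebra.hasNoZeroDivisors_of_isNonassocSemifield h)
  · exact PetitAlgebra.isNonassocSemifield h (by omega)
  · exact PetitAlgebra.hasNoZeroDivisors_of_isNonassocSemifield
      (PetitAlgebra.isNonassocSemifield h (by omega))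
  · exact PetitAlgebra.isIrreducible_of_hasNoZeroDivisors hm' h
  · exact (PetitAlgebra.mem_baseSet_iff hm a).mpr ⟨ha, h a⟩
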